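/- **Setting.** There are $n\ge 2$ agents with signals $\sigma_1,\dots,\sigma_n\in\{0,1\}$ drawn from a joint prior $Q$ on $\{0,1\}^n$. The prior is *symmetric*: all $\sigma_i$ have the same distribution and $\Pr[\sigma_j=s'\mid\sigma_i=s]$ is the same for all $i\ne j$. Write $q(s)=\Pr[\sigma_i=s]$ and $q(s'|s)=\Pr[\sigma_j=s'\mid\sigma_i=s]$. It is *positively correlated*, $q(s|s)>q(s)$ for $s=0,1$; *signal asymmetric*, $q(0)\neq q(1)$; and signals are not perfectly correlated, $q(1|0)>0$. After seeing her signal each agent reports a bit; a strategy $\theta$ is given by the probabilities $\theta(1|0),\theta(1|1)$ of reporting $1$. An equilibrium is a Bayesian Nash equilibrium (no agent can raise her expected payoff by changing her strategy). It is *focal* if it pays every agent strictly more than any other equilibrium does. Let $\mathbf T$ be the profile in which all tell the truth. An equilibrium is *informative* if it is not the profile in which all always report $0$, nor the one in which all always report $1$. **Peer prediction.** A strictly proper scoring rule $PS(b,y)$ ($b\in\{0,1\}$, $y\in[0,1]$) is one for which, for every $p\in[0,1]$, $y\mapsto p\,PS(1,y)+(1-p)PS(0,y)$ has its unique maximum on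 $[0,1]$ at $y=p$. In the corresponding peer-prediction mechanism each agent $i$ is matched with a uniformly random other agent $j$ and, on reports $b_i,b_j$, is paid $h_{b_j,b_i}=PS(b_j,q(1|b_i))$; it is represented by $\begin{pmatrix}h_{1,1}&h_{1,0}\\h_{0,1}&h_{0,0}\end{pmatrix}$. Let $\mathcal U$ be the set of these matrices with smallest entry $0$ and largest entry $1$. Let $\nu^h(\theta)$ be the expected payoff of $\theta$ (averaged over agents), and $$\Delta_Q(h)=\nu^h(\mathbf T)-\max\{\nu^h(\theta):\theta\text{ an informative equilibrium},\ \theta\ne\mathbf T\},\qquad \Delta^*(Q)=\sup_{h\in\mathcal U}\Delta_Q(h).$$ $Q$ is *attainable* if $\Delta_Q(h)=\Delta^*(Q)$ for some $h\in\mathcal U$. **The mechanisms.** Suppose $q(1|1)>q(0|0)$ (if $q(1|1)<q(0|0)$, exchange the names of the two signals throughout). Put $a=q(1|1)$, $b=q(1|0)$, $\bar a=q(0|1)$, $\bar b=q(0|0)$, $s=\sqrt{\bar b\,b\,\bar a\,a}$, $$q_{a,o}=\frac{ab-s}{a-\bar b},\quad \Delta_a=\frac{\bar a(\bar b b-s)(s-\bar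 a a)}{(\bar a+b)\,a\,(a-\bar b)(s+a-\bar b-ab)},\quad \Delta_b=\frac{(a-\bar b)\big(\bar b b(a-\bar a)-\sqrt{\bar b b(a-b)(a-\bar b)}\big)}{(b+\bar a)\,b\,a\,\bar b},$$ $$\iota=\frac{\bar a}{b+\bar a}\cdot\frac{b(a-\bar b)(\bar b-b)}{\bar b\,(ab-(a-\bar b)\bar b)},\quad \kappa=\frac{\bar a}{b+\bar a}\cdot\frac{(a-\bar b)(\bar b-b)}{a(1-\bar b)}.$$ $Q\in R_1$ if $\bar b\le b$, or if $\bar b>b$, $q_{a,o}>\bar b$ and $\Delta_a\ge\Delta_b$. $Q\in R_2$ if $\bar b>b$ and either $q_{a,o}>\bar b$ and $\Delta_a<\Delta_b$, or $q_{a,o}\le\bar b$ and $\min\{\iota,\kappa\}\le\Delta_b$. $Q\in R_3$ if $\bar b>b$, $q_{a,o}\le\bar b$ and $\min\{\iota,\kappa\}>\Delta_b$. Set $$PPM(Q)=\begin{pmatrix}\zeta&0\\0&1\end{pmatrix}\ (Q\in R_1),\qquad PPM(Q)=\begin{pmatrix}1&0\\0&\eta\end{pmatrix}\ (Q\in R_2),\qquad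 PPM(Q,\epsilon)=\begin{pmatrix}\zeta_\epsilon&\delta_\epsilon\\0&1\end{pmatrix}\ (Q\in R_3,\ \epsilon>0),$$ where $\zeta=\sqrt{\frac{\bar b\bar a}{ba}}$, $\eta=\frac1a\Big(\sqrt{\frac{(a-b)(a-\bar b)}{\bar b b}}+\bar a\Big)$ and, with $x=\bar b+\epsilon$, $\zeta_\epsilon=\frac{\bar b\bar a}{\bar b\bar a x+b(a-ax)}$, $\delta_\epsilon=\frac{ba(x-1)^2-\bar b\bar a x^2}{x\,(ba(x-1)-\bar b\bar a x)}$. Let $\epsilon_Q$ be the maximum, over sets of $n-1$ agents, of the probability that all agents of the set receive the same signal. Let $t=\nu^{PPM(Q)}(\mathbf T)$ if $Q$ is attainable and $t=\limsup_{\epsilon\to0^+}\nu^{PPM(Q,\epsilon)}(\mathbf T)$ otherwise. $MPPM(Q)$ (resp. $MPPM(Q,\epsilon)$) pays as $PPM(Q)$ (resp. $PPM(Q,\epsilon)$), except that an agent is charged $p=\frac{1-t}{2(1-\epsilon_Q)}+\frac{\Delta^*(Q)}{2\epsilon_Q}$ whenever all *other* agents make the same report. **Theorem.** $Q$ is attainable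 if and only if $Q\in R_1\cup R_2$, and unattainable if and only if $Q\in R_3$. Moreover: 1. If $Q$ is attainable, then $PPM(Q)\in\mathcal U$, $\Delta_Q(PPM(Q))=\Delta^*(Q)$, and in $PPM(Q)$ truth-telling is an equilibrium that pays every agent strictly more than any other informative equilibrium. If $Q$ is unattainable, then for all sufficiently small $\epsilon>0$ the same membership in $\mathcal U$ and the same strict comparison hold for $PPM(Q,\epsilon)$, and $\lim_{\epsilon\to0^+}\Delta_Q(PPM(Q,\epsilon))=\Delta^*(Q)$. 2. The number $\xi=\frac{\Delta^*(Q)}{1-t+\Delta^*(Q)}$ is positive and depends only on $q(1|1)$ and $q(1|0)$. If $0<\epsilon_Q<\xi$, then truth-telling is focal in $MPPM(Q)$ when $Q$ is attainable, and in $MPPM(Q,\epsilon)$, for all sufficiently small $\epsilon>0$, when $Q$ is unattainable. -/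

import Mathlib

open Filter Topology

namespace PeerPrediction

noncomputable section

/-! Signals and reports are Booleans: `false` is the signal `0` and `true` is the signal `1`.
A prior of `n` agents is a weight function `Q` on the signal vectors `Fin n → Bool`
(an element of the standard simplex). -/

/-- Probability of an event under the prior `Q`. -/
def prob {n : ℕ} (Q : (Fin n → Bool) → ℝ) (E : Set (Fin n → Bool)) : ℝ :=
  ∑ x, E.indicator Q x

/-- `Pr[σ_j = s' | σ_i = s]`. -/
def condProb {n : ℕ} (Q : (Fin n → Bool) → ℝ) (i j : Fin n) (s' s : Bool) : ℝ :=
  prob Q {x | x i = s ∧ x j = s'} / prob Q {x | x i = s}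

/-- `q(s)`: the expected fraction of agents with signal `s`. -/
def q {n : ℕ} (Q : (Fin n → Bool) → ℝ) (s : Bool) : ℝ :=
  (∑ i, prob Q {x | x i = s}) / n

/-- `q(s'|s)`: the expected fraction of other agents with signal `s'`, for an agent with signal
`s` (averaged over the agent; for a symmetric prior all the terms of the average coincide). -/
def qc {n : ℕ} (Q : (Fin n → Bool) → ℝ) (s' s : Bool) : ℝ :=
  (∑ i, ∑ j ∈ Finset.univ.erase i, condProb Q i j s' s) / (n * (n - 1))

/-- Symmetric prior: all signals have the same distribution, and `Pr[σ_j = s' | σ_i = s]`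
does not depend on the pair of distinct agents `i`, `j`. -/
def IsSymmetric {n : ℕ} (Q : (Fin n → Bool) → ℝ) : Prop :=
  (∀ i k s, prob Q {x | x i = s} = prob Q {x | x k = s}) ∧
    ∀ i j k l, i ≠ j → k ≠ l → ∀ s' s, condProb Q i j s' s = condProb Q k l s' s

def IsPositivelyCorrelated {n : ℕ} (Q : (Fin n → Bool) → ℝ) : Prop :=
  ∀ s, q Q s < qc Q s s

def IsSignalAsymmetric {n : ℕ} (Q : (Fin n → Bool) → ℝ) : Prop :=
  q Q false ≠ q Q true

/-! ### Strategies, payoffs, equilibria -/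

/-- A mixed strategy `θ`: `θ s` is the probability `θ(1|s)` of reporting `1` on signal `s`. -/
abbrev Strategy : Type := Bool → unitInterval

/-- `θ(r|s)`. -/
def reportProb (θ : Strategy) (r s : Bool) : ℝ :=
  if r then (θ s : ℝ) else 1 - (θ s : ℝ)

/-- Expected payoff of agent `i` under the profile `θ`, when the mechanism pays `ν i r` to agent
`i` on the vector of reports `r`. -/
def expectedPay {n : ℕ} (Q : (Fin n → Bool) → ℝ) (ν : Fin n → (Fin n → Bool) → ℝ)
    (θ : Fin n → Strategy) (i : Fin n) : ℝ :=
  ∑ x, Q x * ∑ r : Fin n → Bool, (∏ k, reportProb (θ k) (r k) (x k)) * ν i r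

/-- Bayesian Nash equilibrium. -/
def IsEquilibrium {n : ℕ} (Q : (Fin n → Bool) → ℝ) (ν : Fin n → (Fin n → Bool) → ℝ)
    (θ : Fin n → Strategy) : Prop :=
  ∀ (i : Fin n) (θ' : Strategy),
    expectedPay Q ν (Function.update θ i θ') i ≤ expectedPay Q ν θ i

/-- The profile in which all agents tell the truth. -/
def truth (n : ℕ) : Fin n → Strategy := fun _ s => if s then 1 else 0

/-- The profile in which all agents always report `0`. -/
def allZero (n : ℕ) : Fin n → Strategy := fun _ _ => 0

/-- The profile in which all agents always report `1`. -/
def allOne (n : ℕ) : Fin n → Strategy := fun _ _ => 1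

/-- `θ` is focal: it is an equilibrium, and it pays every agent strictly more than any other
equilibrium does. -/
def IsFocal {n : ℕ} (Q : (Fin n → Bool) → ℝ) (ν : Fin n → (Fin n → Bool) → ℝ)
    (θ : Fin n → Strategy) : Prop :=
  IsEquilibrium Q ν θ ∧
    ∀ θ', IsEquilibrium Q ν θ' → θ' ≠ θ → ∀ i, expectedPay Q ν θ' i < expectedPay Q ν θ i

/-- The informative equilibria other than truth-telling. -/
def otherInformative {n : ℕ} (Q : (Fin n → Bool) → ℝ) (ν : Fin n → (Fin n → Bool) → ℝ) :
    Set (Fin n → Strategy) :=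
  {θ | IsEquilibrium Q ν θ ∧ θ ≠ truth n ∧ θ ≠ allZero n ∧ θ ≠ allOne n}

/-- Truth-telling is an equilibrium and pays every agent strictly more than any other informative
equilibrium does. -/
def IsTruthBestInformative {n : ℕ} (Q : (Fin n → Bool) → ℝ)
    (ν : Fin n → (Fin n → Bool) → ℝ) : Prop :=
  IsEquilibrium Q ν (truth n) ∧
    ∀ θ ∈ otherInformative Q ν, ∀ i, expectedPay Q ν θ i < expectedPay Q ν (truth n) i

/-! ### Peer prediction -/

/-- The expected score `PS(p, y)` of the prediction `y` when the signal is `1` with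
probability `p`. -/
def expectedScore (PS : Bool → ℝ → ℝ) (p y : ℝ) : ℝ :=
  p * PS true y + (1 - p) * PS false y

/-- Strictly proper scoring rules on binary signals (predictions are the numbers in `[0,1]`). -/
def IsStrictlyProper (PS : Bool → ℝ → ℝ) : Prop :=
  ∀ p ∈ Set.Icc (0 : ℝ) 1, ∀ y ∈ Set.Icc (0 : ℝ) 1, y ≠ p →
    expectedScore PS p y < expectedScore PS p p

/-- The payoff function matrix: the entry `h b_j b_i` is the payment of an agent who reports
`b_i` and is matched with an agent who reports `b_j`. -/
def payoffMatrix {n : ℕ} (Q : (Fin n → Bool) → ℝ) (PS : Bool → ℝ → ℝ) : Bool → Bool → ℝ :=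
  fun bj bi => PS bj (qc Q true bi)

/-- The payment (in expectation over the uniformly random match) to agent `i` on the reports `r`
in the mechanism with payoff function matrix `h`. -/
def ppPayment {n : ℕ} (h : Bool → Bool → ℝ) (i : Fin n) (r : Fin n → Bool) : ℝ :=
  (∑ j ∈ Finset.univ.erase i, h (r j) (r i)) / (n - 1)

/-- The payoff function matrices of the peer-prediction mechanisms (run with a strictly proper
scoring rule) whose least payoff is `0` and whose greatest payoff is `1`. -/
def unitMechanisms {n : ℕ} (Q : (Fin n → Bool) → ℝ) : Set (Bool → Bool → ℝ) :=
  {h | (∃ PS, IsStrictlyProper PS ∧ h = payoffMatrix Q PS) ∧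
    IsLeast (Set.range fun b : Bool × Bool => h b.1 b.2) 0 ∧
    IsGreatest (Set.range fun b : Bool × Bool => h b.1 b.2) 1}

/-- The expected payoff `ν^h(θ)` of the profile `θ`, averaged over the agents (at a symmetric
profile all agents have the same expected payoff). -/
def value {n : ℕ} (Q : (Fin n → Bool) → ℝ) (h : Bool → Bool → ℝ)
    (θ : Fin n → Strategy) : ℝ :=
  (∑ i, expectedPay Q (ppPayment h) θ i) / n

/-- `Δ_Q(h)`: the advantage of truth-telling over the best other informative equilibrium. -/
def gap {n : ℕ} (Q : (Fin n → Bool) → ℝ) (h : Bool → Bool → ℝ) : ℝ :=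
  value Q h (truth n) - sSup (value Q h '' otherInformative Q (ppPayment h))

/-- `Δ*(Q)`. -/
def optGap {n : ℕ} (Q : (Fin n → Bool) → ℝ) : ℝ :=
  sSup (gap Q '' unitMechanisms Q)

def IsAttainable {n : ℕ} (Q : (Fin n → Bool) → ℝ) : Prop :=
  ∃ h ∈ unitMechanisms Q, gap Q h = optGap Q

/-! ### The tuned mechanisms

Here `c s' s` stands for `q(s'|s)`, and the formulas are for the orientation `q(0|0) < q(1|1)`. -/

/-- The matrix with rows `(h₁₁, h₁₀)` and `(h₀₁, h₀₀)`. -/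
def mat (h11 h10 h01 h00 : ℝ) : Bool → Bool → ℝ
  | true, true => h11
  | true, false => h10
  | false, true => h01
  | false, false => h00

section Formulas

variable (c : Bool → Bool → ℝ)

/-- `√(q(0|0) q(1|0) q(0|1) q(1|1))`. -/
def rad : ℝ :=
  √(c false false * c true false * c false true * c true true)

/-- `q*_{a,o}`. -/
def qao : ℝ :=
  (c true false * c true true - rad c) / (c true true - c false false)

/-- `Δ*_a`. -/
def deltaA : ℝ :=
  (c false true * (c false false * c true false - rad c) * (rad c - c false true * c true true)) /
    ((c false true + c true false) * c true true * (c true true - c false false) *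
      (rad c + c true true - c false false - c true false * c true true))

/-- `Δ*_b`. -/
def deltaB : ℝ :=
  ((c true true - c false false) *
      (c false false * c true false * (c true true - c false true) -
        √(c false false * c true false * (c true true - c true false) *
          (c true true - c false false)))) /
    ((c true false + c false true) * c true false * c true true * c false false)

/-- `ι_a(q(0|0))`. -/
def iotaA : ℝ :=
  c false true / (c true false + c false true) *
    ((c true false * (c true true - c false false) * (c false false - c true false)) /
      (c false false *
        (c true false * c true true - (c true true - c false false) * c false false)))

/-- `κ_a(q(0|0))`. -/
def kappaA : ℝ :=
  c false true / (c true false + c false true) *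
    (((c true true - c false false) * (c false false - c true false)) /
      (c true true * (1 - c false false)))

def InR1 : Prop :=
  c false false ≤ c true false ∨
    (c true false < c false false ∧ c false false < qao c ∧ deltaB c ≤ deltaA c)

def InR2 : Prop :=
  (c true false < c false false ∧ c false false < qao c ∧ deltaA c < deltaB c) ∨
    (c true false < c false false ∧ qao c ≤ c false false ∧ min (iotaA c) (kappaA c) ≤ deltaB c)

def InR3 : Prop :=
  c true false < c false false ∧ qao c ≤ c false false ∧ deltaB c < min (iotaA c) (kappaA c)

def zeta : ℝ :=
  √((c false false * c false true) / (c true false * c true true))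

def eta : ℝ :=
  1 / c true true *
    (√(((c true true - c true false) * (c true true - c false false)) /
      (c false false * c true false)) + c false true)

/-- `ζ(Q, ε)`. -/
def zetaEps (ε : ℝ) : ℝ :=
  (c false false * c false true) /
    (c false false * c false true * (c false false + ε) +
      c true false * (c true true - c true true * (c false false + ε)))

/-- `δ(Q, ε)`. -/
def deltaEps (ε : ℝ) : ℝ :=
  (c true false * c true true * (c false false + ε - 1) ^ 2 -
      c false false * c false true * (c false false + ε) ^ 2) /
    ((c false false + ε) *
      (c true false * c true true * (c false false + ε - 1) -
        c false false * c false true * (c false false + ε)))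

open Classical in
/-- `M₁` on `R₁` and `M₂` on `R₂` (the value on `R₃` is not used). -/
def tuned : Bool → Bool → ℝ :=
  if InR1 c then mat (zeta c) 0 0 1 else mat 1 0 0 (eta c)

/-- `M₃(ε)`. -/
def tunedEps (ε : ℝ) : Bool → Bool → ℝ :=
  mat (zetaEps c ε) (deltaEps c ε) 0 1

end Formulas

/-- The conditional probabilities after the two signals are exchanged, if this is needed to have
`q(0|0) < q(1|1)`. -/
def oriented {n : ℕ} (Q : (Fin n → Bool) → ℝ) : Bool → Bool → ℝ :=
  if qc Q false false < qc Q true true then qc Q else fun s' s => qc Q (!s') (!s)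

/-- Translates a matrix for the oriented conditional probabilities back to the original signals. -/
def unorient {n : ℕ} (Q : (Fin n → Bool) → ℝ) (h : Bool → Bool → ℝ) : Bool → Bool → ℝ :=
  if qc Q false false < qc Q true true then h else fun bj bi => h (!bj) (!bi)

/-- The mechanism `PPM(Q)`, for `Q` in `R₁ ∪ R₂`. -/
def PPM {n : ℕ} (Q : (Fin n → Bool) → ℝ) : Bool → Bool → ℝ :=
  unorient Q (tuned (oriented Q))

/-- The mechanism `PPM(Q, ε)`, for `Q` in `R₃`. -/
def PPMEps {n : ℕ} (Q : (Fin n → Bool) → ℝ) (ε : ℝ) : Bool → Bool → ℝ :=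
  unorient Q (tunedEps (oriented Q) ε)

/-! ### The punishment -/

/-- `ε_Q`: the maximal probability that a fixed set of `n - 1` agents (all agents but `i`)
receive the same signal. -/
def epsQ {n : ℕ} (Q : (Fin n → Bool) → ℝ) : ℝ :=
  ⨆ i : Fin n, prob Q {x | ∃ b, ∀ j, j ≠ i → x j = b}

open Classical in
/-- `t`: the expected payoff of truth-telling in `PPM(Q)`, or its upper limit in `PPM(Q, ε)`. -/
def truthPay {n : ℕ} (Q : (Fin n → Bool) → ℝ) : ℝ :=
  if IsAttainable Q then value Q (PPM Q) (truth n)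
  else limsup (fun ε : ℝ => value Q (PPMEps Q ε) (truth n)) (𝓝[>] 0)

def punishment {n : ℕ} (Q : (Fin n → Bool) → ℝ) : ℝ :=
  (1 - truthPay Q) / (2 * (1 - epsQ Q)) + optGap Q / (2 * epsQ Q)

/-- `Δ*(Q) / (1 - t + Δ*(Q))`. -/
def threshold {n : ℕ} (Q : (Fin n → Bool) → ℝ) : ℝ :=
  optGap Q / (1 - truthPay Q + optGap Q)

/-- Peer prediction with the matrix `h`, where in addition an agent is punished by `p` whenever
all the other agents report the same signal. -/
def punishedPayment {n : ℕ} (h : Bool → Bool → ℝ) (p : ℝ) (i : Fin n) (r : Fin n → Bool) : ℝ :=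
  ppPayment h i r - if ∃ b, ∀ j, j ≠ i → r j = b then p else 0

/-- The payments of `MPPM(Q)`. -/
def MPPM {n : ℕ} (Q : (Fin n → Bool) → ℝ) : Fin n → (Fin n → Bool) → ℝ :=
  punishedPayment (PPM Q) (punishment Q)

/-- The payments of `MPPM(Q, ε)`. -/
def MPPMEps {n : ℕ} (Q : (Fin n → Bool) → ℝ) (ε : ℝ) : Fin n → (Fin n → Bool) → ℝ :=
  punishedPayment (PPMEps Q ε) (punishment Q)

end

end PeerPrediction

namespace PeerPrediction

noncomputable section

/-! ### The reduced model: symmetric profiles, described by `a = q(1|1)` and `b = q(1|0)` -/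

/-- The conditional probabilities with `q(1|1) = a` and `q(1|0) = b`. -/
def cc (a b : ℝ) : Bool → Bool → ℝ
  | true, true => a
  | true, false => b
  | false, true => 1 - a
  | false, false => 1 - b

/-- The marginal distribution determined by `a` and `b`. -/
def wt (a b : ℝ) : Bool → ℝ
  | true => b / (b + (1 - a))
  | false => (1 - a) / (b + (1 - a))

/-- Probability that another agent, playing `θ`, reports `1`, given the own signal `s`. -/
def reportOne (a b : ℝ) (θ : Strategy) (s : Bool) : ℝ :=
  θ true * cc a b true s + θ false * cc a b false s

/-- Expected payment for the report `u` if the peer reports `1` with probability `p`. -/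
def payFor (h : Bool → Bool → ℝ) (u : Bool) (p : ℝ) : ℝ :=
  p * h true u + (1 - p) * h false u

/-- Payoff of the symmetric profile in which everybody plays `θ`. -/
def symPay (a b : ℝ) (h : Bool → Bool → ℝ) (θ : Strategy) : ℝ :=
  ∑ s, wt a b s * (θ s * payFor h true (reportOne a b θ s) +
    (1 - θ s) * payFor h false (reportOne a b θ s))

/-- The condition for everybody playing `θ` to be an equilibrium. -/
def SymEq (a b : ℝ) (h : Bool → Bool → ℝ) (θ : Strategy) : Prop :=
  ∀ s, (payFor h false (reportOne a b θ s) < payFor h true (reportOne a b θ s) → θ s = 1) ∧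
    (payFor h true (reportOne a b θ s) < payFor h false (reportOne a b θ s) → θ s = 0)

def honest : Strategy := fun s => if s then 1 else 0

/-- The informative symmetric equilibria other than truth-telling. -/
def symOthers (a b : ℝ) (h : Bool → Bool → ℝ) : Set Strategy :=
  {θ | SymEq a b h θ ∧ θ ≠ honest ∧ θ ≠ (fun _ => 0) ∧ θ ≠ (fun _ => 1)}

def symGap (a b : ℝ) (h : Bool → Bool → ℝ) : ℝ :=
  symPay a b h honest - sSup (symPay a b h '' symOthers a b h)

/-- Matrices with entries in `[0,1]`, both ends attained, for which truth-telling is strict. -/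
def Admissible (a b : ℝ) (h : Bool → Bool → ℝ) : Prop :=
  (∀ i j, 0 ≤ h i j ∧ h i j ≤ 1) ∧ (∃ i j, h i j = 0) ∧ (∃ i j, h i j = 1) ∧
    payFor h false a < payFor h true a ∧ payFor h true b < payFor h false b

def symOpt (a b : ℝ) : ℝ :=
  sSup (symGap a b '' {h | Admissible a b h})

def SymAttainable (a b : ℝ) : Prop :=
  ∃ h, Admissible a b h ∧ symGap a b h = symOpt a b

lemma strategy_ext {θ θ' : Strategy} (h0 : (θ false : ℝ) = θ' false)
    (h1 : (θ true : ℝ) = θ' true) : θ = θ' := by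
  funext s
  cases s
  · exact Subtype.ext h0
  · exact Subtype.ext h1

lemma payFor_mem {h : Bool → Bool → ℝ} (hh : ∀ i j, 0 ≤ h i j ∧ h i j ≤ 1) (u : Bool) {p : ℝ}
    (h0 : 0 ≤ p) (h1 : p ≤ 1) : 0 ≤ payFor h u p ∧ payFor h u p ≤ 1 := by
  have A := hh true u
  have B := hh false u
  unfold payFor
  constructor
  · have := mul_nonneg h0 A.1
    have := mul_nonneg (sub_nonneg.2 h1) B.1
    linarith
  · have := mul_nonneg h0 (sub_nonneg.2 A.2)
    have := mul_nonneg (sub_nonneg.2 h1) (sub_nonneg.2 B.2)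
    linarith

section

variable {a b : ℝ} {h : Bool → Bool → ℝ}

lemma reportOne_mem (hb : 0 ≤ b) (hab : b ≤ a) (ha : a ≤ 1) (θ : Strategy) (s : Bool) :
    0 ≤ reportOne a b θ s ∧ reportOne a b θ s ≤ 1 := by
  have t0 := (θ true).2.1
  have t1 := (θ true).2.2
  have f0 := (θ false).2.1
  have f1 := (θ false).2.2
  cases s <;> simp only [reportOne, cc] <;> constructor <;>
    nlinarith [mul_nonneg t0 hb, mul_nonneg t0 (hb.trans hab), mul_nonneg f0 (sub_nonneg.2 ha),
      mul_nonneg f0 (sub_nonneg.2 (hab.trans ha)), mul_nonneg (sub_nonneg.2 t1) hb,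
      mul_nonneg (sub_nonneg.2 t1) (hb.trans hab), mul_nonneg (sub_nonneg.2 f1) (sub_nonneg.2 ha),
      mul_nonneg (sub_nonneg.2 f1) (sub_nonneg.2 (hab.trans ha))]

lemma symPay_eq (a b : ℝ) (h : Bool → Bool → ℝ) (θ : Strategy) :
    symPay a b h θ = (b * (θ true * payFor h true (θ true * a + θ false * (1 - a)) +
        (1 - θ true) * payFor h false (θ true * a + θ false * (1 - a))) +
      (1 - a) * (θ false * payFor h true (θ true * b + θ false * (1 - b)) +
        (1 - θ false) * payFor h false (θ true * b + θ false * (1 - b)))) / (b + (1 - a)) := by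
  simp only [symPay, Fintype.sum_bool, wt, reportOne, cc]
  ring

lemma symPay_mem (hb : 0 < b) (hab : b ≤ a) (ha : a ≤ 1)
    (hh : ∀ i j, 0 ≤ h i j ∧ h i j ≤ 1) (θ : Strategy) :
    0 ≤ symPay a b h θ ∧ symPay a b h θ ≤ 1 := by
  have hD : 0 < b + (1 - a) := by linarith
  have w1 : 0 ≤ wt a b true := by unfold wt; positivity
  have w0 : 0 ≤ wt a b false := by unfold wt; exact div_nonneg (by linarith) hD.le
  have ws : wt a b true + wt a b false = 1 := by unfold wt; field_simp
  have key : ∀ s, 0 ≤ (θ s * payFor h true (reportOne a b θ s) +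
      (1 - θ s) * payFor h false (reportOne a b θ s)) ∧
      (θ s * payFor h true (reportOne a b θ s) +
      (1 - θ s) * payFor h false (reportOne a b θ s)) ≤ 1 := by
    intro s
    have hp := reportOne_mem hb.le hab ha θ s
    have A := payFor_mem hh true hp.1 hp.2
    have B := payFor_mem hh false hp.1 hp.2
    have t0 := (θ s).2.1
    have t1 := (θ s).2.2
    constructor <;> nlinarith [mul_nonneg t0 A.1, mul_nonneg (sub_nonneg.2 t1) B.1,
      mul_nonneg t0 (sub_nonneg.2 A.2), mul_nonneg (sub_nonneg.2 t1) (sub_nonneg.2 B.2)]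
  simp only [symPay, Fintype.sum_bool]
  have k1 := key true
  have k0 := key false
  constructor
  · have := mul_nonneg w1 k1.1
    have := mul_nonneg w0 k0.1
    linarith
  · have := mul_le_mul_of_nonneg_left k1.2 w1
    have := mul_le_mul_of_nonneg_left k0.2 w0
    linarith

lemma bddAbove_symPay (hb : 0 < b) (hab : b ≤ a) (ha : a ≤ 1)
    (hh : ∀ i j, 0 ≤ h i j ∧ h i j ≤ 1) (S : Set Strategy) : BddAbove (symPay a b h '' S) :=
  ⟨1, by rintro _ ⟨θ, -, rfl⟩; exact (symPay_mem hb hab ha hh θ).2⟩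

/-- A normal form of an admissible matrix: `x = h₁₁ - h₀₁`, `y = h₀₀ - h₁₀`, and reporting `1` is
better exactly if the peer reports `1` with a probability above `q`. -/
lemma Admissible.normalForm (hab : b < a) (H : Admissible a b h) :
    ∃ x y q : ℝ, x = h true true - h false true ∧ y = h false false - h true false ∧
      q * (x + y) = h false false - h false true ∧ 0 < x + y ∧ b < q ∧ q < a ∧
      x ≤ 1 ∧ y ≤ 1 ∧ q * (x + y) ≤ 1 ∧ (1 - q) * (x + y) ≤ 1 := by
  obtain ⟨hh, -, -, h1, h2⟩ := H
  simp only [payFor] at h1 h2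
  -- The advantage of reporting 1 is affine in the peer's probability of 1, with slope x + y; it is
  -- negative at b and positive at a.
  have K : 0 < (h true true - h false true) + (h false false - h true false) := by
    by_contra hK
    push Not at hK
    nlinarith [mul_nonneg (sub_nonneg.2 hab.le) (neg_nonneg.2 hK)]
  refine ⟨_, _, (h false false - h false true) /
    ((h true true - h false true) + (h false false - h true false)), rfl, rfl, ?_, K, ?_, ?_, ?_⟩
  · field_simp
  · rw [lt_div_iff₀ K]; linarith
  · rw [div_lt_iff₀ K]; linarith
  · have A := hh true true
    have B := hh true false
    have C := hh false true
    have E := hh false false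
    refine ⟨by linarith, by linarith, ?_, ?_⟩
    · rw [div_mul_cancel₀ _ K.ne']; linarith
    · rw [one_sub_mul, div_mul_cancel₀ _ K.ne']; linarith

/-! #### Exchanging the names of the signals -/

/-- Renaming signals and reports together turns (a, b) into (1 - b, 1 - a) and reverses the sign of
a + b - 1. All quantities of the reduced model are invariant, so a + b > 1 may be assumed. -/
def flipMat (h : Bool → Bool → ℝ) : Bool → Bool → ℝ := fun i j => h (!i) (!j)

def flipStrategy (θ : Strategy) : Strategy := fun s => unitInterval.symm (θ (!s))

lemma flipMat_flipMat (h : Bool → Bool → ℝ) : flipMat (flipMat h) = h := by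
  funext i j; simp [flipMat]

lemma flipStrategy_flipStrategy (θ : Strategy) : flipStrategy (flipStrategy θ) = θ := by
  funext s; simp [flipStrategy]

lemma flipStrategy_honest : flipStrategy honest = honest := by
  funext s; cases s <;> simp [flipStrategy, honest]

lemma cc_flip (a b : ℝ) : (fun s' s => cc a b (!s') (!s)) = cc (1 - b) (1 - a) := by
  funext s' s; cases s <;> cases s' <;> simp [cc]

lemma reportOne_flip (θ : Strategy) (s : Bool) :
    reportOne (1 - b) (1 - a) (flipStrategy θ) s = 1 - reportOne a b θ (!s) := by
  cases s <;> simp [reportOne, cc, flipStrategy] <;> ring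

lemma payFor_flip (u : Bool) (p : ℝ) : payFor (flipMat h) u (1 - p) = payFor h (!u) p := by
  simp only [payFor, flipMat]; simp; ring

lemma symPay_flip (θ : Strategy) :
    symPay (1 - b) (1 - a) (flipMat h) (flipStrategy θ) = symPay a b h θ := by
  simp only [symPay, Fintype.sum_bool, reportOne_flip, payFor_flip]
  simp only [wt, flipStrategy, unitInterval.coe_symm_eq, Bool.not_true, Bool.not_false]
  ring

lemma symEq_flip {θ : Strategy} (H : SymEq a b h θ) :
    SymEq (1 - b) (1 - a) (flipMat h) (flipStrategy θ) := by
  intro s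
  rw [reportOne_flip, payFor_flip, payFor_flip]
  refine ⟨fun h1 => ?_, fun h1 => ?_⟩
  · have := (H (!s)).2 h1
    simp [flipStrategy, this]
  · have := (H (!s)).1 h1
    simp [flipStrategy, this]

lemma symOthers_flip {θ : Strategy} (H : θ ∈ symOthers a b h) :
    flipStrategy θ ∈ symOthers (1 - b) (1 - a) (flipMat h) := by
  obtain ⟨h1, h2, h3, h4⟩ := H
  refine ⟨symEq_flip h1, fun e => h2 ?_, fun e => h4 ?_, fun e => h3 ?_⟩ <;>
    have := congrArg flipStrategy e <;> rw [flipStrategy_flipStrategy] at this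
  · rw [this, flipStrategy_honest]
  · rw [this]; funext s; simp [flipStrategy]
  · rw [this]; funext s; simp [flipStrategy]

lemma symGap_flip : symGap (1 - b) (1 - a) (flipMat h) = symGap a b h := by
  unfold symGap
  congr 1
  · rw [← symPay_flip (a := a) (b := b), flipStrategy_honest]
  · congr 1
    ext v
    constructor
    · rintro ⟨θ, hθ, rfl⟩
      refine ⟨flipStrategy θ, ?_, ?_⟩
      · have := symOthers_flip hθ
        simpa [flipMat_flipMat] using this
      · rw [← symPay_flip, flipStrategy_flipStrategy]
    · rintro ⟨θ, hθ, rfl⟩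
      exact ⟨_, symOthers_flip hθ, symPay_flip θ⟩

lemma Admissible.flip (H : Admissible a b h) : Admissible (1 - b) (1 - a) (flipMat h) := by
  obtain ⟨h1, ⟨i, j, h2⟩, ⟨k, l, h3⟩, h4, h5⟩ := H
  refine ⟨fun i j => h1 _ _, ⟨!i, !j, by simpa [flipMat] using h2⟩,
    ⟨!k, !l, by simpa [flipMat] using h3⟩, ?_, ?_⟩
  · simpa [payFor_flip] using h5
  · simpa [payFor_flip] using h4

lemma admissible_flip_iff : Admissible (1 - b) (1 - a) (flipMat h) ↔ Admissible a b h := by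
  refine ⟨fun H => ?_, Admissible.flip⟩
  simpa [flipMat_flipMat] using H.flip

lemma symOpt_flip : symOpt (1 - b) (1 - a) = symOpt a b := by
  unfold symOpt
  congr 1
  ext v
  constructor
  · rintro ⟨h, hh, rfl⟩
    refine ⟨flipMat h, ?_, ?_⟩
    · have := Admissible.flip hh
      simpa using this
    · rw [← symGap_flip, flipMat_flipMat]
  · rintro ⟨h, hh, rfl⟩
    exact ⟨_, Admissible.flip hh, symGap_flip⟩

lemma symAttainable_flip (H : SymAttainable a b) : SymAttainable (1 - b) (1 - a) := by
  obtain ⟨h, h1, h2⟩ := H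
  exact ⟨_, h1.flip, by rw [symGap_flip, h2, symOpt_flip]⟩

lemma symAttainable_flip_iff : SymAttainable (1 - b) (1 - a) ↔ SymAttainable a b := by
  refine ⟨fun H => ?_, symAttainable_flip⟩
  simpa using symAttainable_flip H

end

end

noncomputable section

/-! ### From the prior to the reduced model -/

/-- The joint law of the signals of any two agents is the one given by `a` and `b`. -/
structure PairLaw {n : ℕ} (Q : (Fin n → Bool) → ℝ) (a b : ℝ) : Prop where
  two_le : 2 ≤ n
  nonneg : ∀ x, 0 ≤ Q x
  total : ∑ x, Q x = 1
  b_pos : 0 < b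
  b_lt : b < a
  a_lt : a < 1
  pair : ∀ i j, i ≠ j → ∀ s s', prob Q {x | x i = s ∧ x j = s'} = wt a b s * cc a b s' s

lemma prob_nonneg {n : ℕ} {Q : (Fin n → Bool) → ℝ} (hQ : ∀ x, 0 ≤ Q x)
    (E : Set (Fin n → Bool)) : 0 ≤ prob Q E :=
  Finset.sum_nonneg fun x _ => Set.indicator_nonneg (fun x _ => hQ x) x

lemma prob_split {n : ℕ} (Q : (Fin n → Bool) → ℝ) (E : Set (Fin n → Bool)) (j : Fin n) :
    prob Q {x | x ∈ E ∧ x j = true} + prob Q {x | x ∈ E ∧ x j = false} = prob Q E := by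
  classical
  unfold prob
  rw [← Finset.sum_add_distrib]
  refine Finset.sum_congr rfl fun x _ => ?_
  rcases h : x j <;> simp [Set.indicator_apply, h]

lemma sum_mul_eq_prob {n : ℕ} (Q : (Fin n → Bool) → ℝ) (i j : Fin n) (G : Bool → Bool → ℝ) :
    ∑ x, Q x * G (x i) (x j) = ∑ s, ∑ s', prob Q {x | x i = s ∧ x j = s'} * G s s' := by
  classical
  simp only [prob, Fintype.sum_bool, Finset.sum_mul, ← Finset.sum_add_distrib]
  refine Finset.sum_congr rfl fun x _ => ?_
  rcases hi : x i <;> rcases hj : x j <;> simp [hi, hj]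

/-- A symmetric prior with the assumed properties has a pair law. -/
lemma exists_pairLaw {n : ℕ} {Q : (Fin n → Bool) → ℝ} (hn : 2 ≤ n)
    (hQ : Q ∈ stdSimplex ℝ (Fin n → Bool)) (hs : IsSymmetric Q) (hp : IsPositivelyCorrelated Q)
    (ha : IsSignalAsymmetric Q) (hb : 0 < qc Q true false) :
    ∃ a b, PairLaw Q a b ∧ qc Q = cc a b ∧ a + b ≠ 1 := by
  obtain ⟨hQ0, hQ1⟩ := hQ
  set i₀ : Fin n := ⟨0, by omega⟩
  set i₁ : Fin n := ⟨1, by omega⟩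
  have h01 : i₀ ≠ i₁ := by simp [i₀, i₁, Fin.ext_iff]
  have hn0 : (n : ℝ) ≠ 0 := by positivity
  have hn1 : (n : ℝ) - 1 ≠ 0 := by
    have : (2 : ℝ) ≤ n := by exact_mod_cast hn
    linarith
  have hq : ∀ i s, prob Q {x | x i = s} = q Q s := by
    intro i s
    unfold q
    rw [Finset.sum_congr rfl (fun k _ => hs.1 k i s)]
    simp [hn0]
  have hqc : ∀ i j, i ≠ j → ∀ s' s, condProb Q i j s' s = qc Q s' s := by
    intro i j hij s' s
    unfold qc
    have : ∀ k ∈ Finset.univ, ∑ l ∈ Finset.univ.erase k, condProb Q k l s' s =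
        ((n : ℝ) - 1) * condProb Q i j s' s := by
      intro k _
      rw [Finset.sum_congr rfl (fun l hl => hs.2 k l i j (Finset.ne_of_mem_erase hl).symm hij s' s)]
      rw [Finset.sum_const, Finset.card_erase_of_mem (Finset.mem_univ _), Finset.card_univ,
        Fintype.card_fin, nsmul_eq_mul, Nat.cast_sub (by omega)]
      simp
    rw [Finset.sum_congr rfl this]
    simp only [Finset.sum_const, Finset.card_univ, Fintype.card_fin, nsmul_eq_mul]
    field_simp
  have hqs : q Q true + q Q false = 1 := by
    rw [← hq i₀ true, ← hq i₀ false, ← hQ1]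
    have := prob_split Q Set.univ i₀
    simpa [prob] using this
  have hq0 : ∀ s, 0 ≤ q Q s := fun s => by rw [← hq i₀ s]; exact prob_nonneg hQ0 _
  have joint_le : ∀ i j s s', prob Q {x | x i = s ∧ x j = s'} ≤ prob Q {x | x i = s} := by
    intro i j s s'
    have := prob_split Q {x | x i = s} j
    have h1 := prob_nonneg hQ0 {x | x ∈ {x | x i = s} ∧ x j = true}
    have h2 := prob_nonneg hQ0 {x | x ∈ {x | x i = s} ∧ x j = false}
    simp only [Set.mem_ofPred_eq] at this h1 h2
    cases s' <;> linarith
  have hjoint : ∀ i j, i ≠ j → ∀ s s',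
      prob Q {x | x i = s ∧ x j = s'} = q Q s * qc Q s' s := by
    intro i j hij s s'
    rw [← hqc i j hij, condProb, hq]
    -- A null signal makes the conditional probability a quotient by zero, but then the joint
    -- probability vanishes as well.
    by_cases h0 : q Q s = 0
    · have h1 := joint_le i j s s'
      rw [hq, h0] at h1
      rw [h0, zero_mul]
      exact le_antisymm h1 (prob_nonneg hQ0 _)
    · field_simp
  -- If q(0) were 0, the quotient defining q(1|0) would be 0 by convention.
  have hf : 0 < q Q false := by
    refine (hq0 false).lt_of_ne fun h0 => hb.ne' ?_
    rw [← hqc i₀ i₁ h01, condProb, hq, ← h0, div_zero]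
  have hswap : q Q true * qc Q false true = q Q false * qc Q true false := by
    rw [← hjoint i₀ i₁ h01, ← hjoint i₁ i₀ h01.symm]
    congr 1
    ext x
    simp [and_comm]
  have ht : 0 < q Q true := by
    have : 0 < q Q true * qc Q false true := by rw [hswap]; positivity
    refine (hq0 true).lt_of_ne fun h0 => ?_
    rw [← h0, zero_mul] at this
    exact this.false
  have hA : 0 < qc Q false true := by
    have : 0 < q Q true * qc Q false true := by rw [hswap]; positivity
    exact (pos_iff_pos_of_mul_pos this).1 ht
  have hcs : ∀ s, qc Q true s + qc Q false s = 1 := by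
    intro s
    have h := prob_split Q {x | x i₀ = s} i₁
    simp only [Set.mem_ofPred_eq] at h
    rw [hjoint _ _ h01, hjoint _ _ h01, hq] at h
    have h0 : q Q s ≠ 0 := by cases s <;> [exact hf.ne'; exact ht.ne']
    exact mul_left_cancel₀ h0 (by linarith)
  have c1 := hcs true
  have c0 := hcs false
  have p1 := hp true
  have p0 := hp false
  -- Positive correlation for the two signals says q(1) < a and b < q(1).
  have hlt : qc Q true false < qc Q true true := by linarith
  have hc : qc Q = cc (qc Q true true) (qc Q true false) := by
    funext s' s
    cases s <;> cases s' <;> simp only [cc] <;> linarith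
  have hD : 0 < qc Q true false + (1 - qc Q true true) := by linarith
  have hw : ∀ s, q Q s = wt (qc Q true true) (qc Q true false) s := by
    have e1 : qc Q false true = 1 - qc Q true true := by linarith
    have e2 : q Q false = 1 - q Q true := by linarith
    rw [e1, e2] at hswap
    intro s
    cases s
    · simp only [wt]
      rw [eq_div_iff hD.ne', e2]
      linarith
    · simp only [wt]
      rw [eq_div_iff hD.ne']
      linarith
  refine ⟨qc Q true true, qc Q true false, ⟨hn, hQ0, hQ1, hb, hlt, by linarith, ?_⟩, hc, ?_⟩
  · intro i j hij s s'
    rw [hjoint i j hij, hw s, ← hc]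
  · intro h
    apply ha
    have e : qc Q false true = qc Q true false := by linarith
    rw [e] at hswap
    exact (mul_right_cancel₀ hb.ne' hswap).symm

/-! #### Expected payments -/

lemma sum_reportProb (θ : Strategy) (s : Bool) : ∑ u, reportProb θ u s = 1 := by
  simp [reportProb]

/-- Under a product law a function of two coordinates sees only their marginals: the indicators of
the two values are absorbed into the factors i and j, and the sum of products becomes a product of
sums. -/
lemma sum_prod_mul_pair {n : ℕ} (f : Fin n → Bool → ℝ) (hf : ∀ k, ∑ u, f k u = 1) {i j : Fin n}
    (hij : i ≠ j) (g : Bool → Bool → ℝ) :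
    ∑ r : Fin n → Bool, (∏ k, f k (r k)) * g (r i) (r j) =
      ∑ u, ∑ v, f i u * f j v * g u v := by
  classical
  have key : ∀ u v, ∑ r : Fin n → Bool,
      (∏ k, f k (r k)) * ((if r i = u then 1 else 0) * (if r j = v then 1 else 0)) =
      f i u * f j v := by
    intro u v
    set f' : Fin n → Bool → ℝ := fun k c =>
      f k c * ((if k = i then (if c = u then 1 else 0) else 1) *
        (if k = j then (if c = v then 1 else 0) else 1)) with hf'
    have e1 : ∀ r : Fin n → Bool,
        (∏ k, f k (r k)) * ((if r i = u then 1 else 0) * (if r j = v then 1 else 0)) =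
        ∏ k, f' k (r k) := by
      intro r
      simp only [hf', Finset.prod_mul_distrib, Finset.prod_ite_eq', Finset.mem_univ, if_true]
    rw [Finset.sum_congr rfl fun r _ => e1 r]
    have e2 : ∑ r : Fin n → Bool, ∏ k, f' k (r k) = ∏ k, ∑ c, f' k c := by
      rw [Finset.prod_univ_sum, Fintype.piFinset_univ]
    rw [e2, Finset.prod_eq_mul i j hij]
    · simp [hf', hij, hij.symm]
    · rintro k - ⟨hk1, hk2⟩
      simpa [hf', hk1, hk2] using hf k
    · simp
    · simp
  simp only [← key, Finset.sum_mul]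
  simp only [Fintype.sum_bool, ← Finset.sum_add_distrib]
  refine Finset.sum_congr rfl fun r _ => ?_
  cases r i <;> cases r j <;> simp

variable {n : ℕ} {Q : (Fin n → Bool) → ℝ} {a b : ℝ}

/-- Probability that a random other agent reports `1`, given the signal `s` of agent `i`. -/
def peerOne (a b : ℝ) (θ : Fin n → Strategy) (i : Fin n) (s : Bool) : ℝ :=
  (∑ j ∈ Finset.univ.erase i, reportOne a b (θ j) s) / (n - 1)

lemma sum_erase_const (hn : 2 ≤ n) (i : Fin n) (c : ℝ) :
    (∑ _j ∈ Finset.univ.erase i, c) / ((n : ℝ) - 1) = c := by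
  have hn1 : (n : ℝ) - 1 ≠ 0 := by
    have : (2 : ℝ) ≤ n := by exact_mod_cast hn
    linarith
  rw [Finset.sum_const, Finset.card_erase_of_mem (Finset.mem_univ _), Finset.card_univ,
    Fintype.card_fin, nsmul_eq_mul, Nat.cast_sub (by omega), div_eq_iff hn1]
  push_cast
  ring

/-- `payFor` is affine in the probability. Hence facing a random peer amounts to facing one peer
with the averaged report probability `peerOne`. -/
lemma payFor_average (hn : 2 ≤ n) (i : Fin n) (h : Bool → Bool → ℝ) (u : Bool) (p : Fin n → ℝ) :
    (∑ j ∈ Finset.univ.erase i, payFor h u (p j)) / ((n : ℝ) - 1) =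
      payFor h u ((∑ j ∈ Finset.univ.erase i, p j) / ((n : ℝ) - 1)) := by
  have e : ∀ t, payFor h u t = t * (h true u - h false u) + h false u := by
    intro t; unfold payFor; ring
  simp only [e]
  rw [Finset.sum_add_distrib, add_div, sum_erase_const hn, ← Finset.sum_mul]
  ring

lemma PairLaw.pair_pay (H : PairLaw Q a b) (h : Bool → Bool → ℝ) (θ : Fin n → Strategy)
    {i j : Fin n} (hij : i ≠ j) :
    ∑ x, Q x * ∑ r : Fin n → Bool, (∏ k, reportProb (θ k) (r k) (x k)) * h (r j) (r i) =
      ∑ s, wt a b s * (θ i s * payFor h true (reportOne a b (θ j) s) +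
        (1 - θ i s) * payFor h false (reportOne a b (θ j) s)) := by
  have e : ∀ x : Fin n → Bool,
      ∑ r : Fin n → Bool, (∏ k, reportProb (θ k) (r k) (x k)) * h (r j) (r i) =
      (fun s s' => ∑ u, ∑ v, reportProb (θ i) u s * reportProb (θ j) v s' * h v u) (x i) (x j) :=
    fun x => sum_prod_mul_pair (fun k u => reportProb (θ k) u (x k))
      (fun k => sum_reportProb _ _) hij (fun u v => h v u)
  rw [Finset.sum_congr rfl fun x _ => by rw [e x], sum_mul_eq_prob Q i j
    (fun s s' => ∑ u, ∑ v, reportProb (θ i) u s * reportProb (θ j) v s' * h v u)]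
  refine Finset.sum_congr rfl fun s _ => ?_
  rw [Fintype.sum_bool, H.pair i j hij, H.pair i j hij]
  have hc : cc a b false s = 1 - cc a b true s := by cases s <;> rfl
  simp only [Fintype.sum_bool, reportProb, payFor, reportOne, hc]
  simp
  ring

lemma PairLaw.expectedPay_eq (H : PairLaw Q a b) (h : Bool → Bool → ℝ) (θ : Fin n → Strategy)
    (i : Fin n) : expectedPay Q (ppPayment h) θ i =
      ∑ s, wt a b s * (θ i s * payFor h true (peerOne a b θ i s) +
        (1 - θ i s) * payFor h false (peerOne a b θ i s)) := by
  have e : expectedPay Q (ppPayment h) θ i = (∑ j ∈ Finset.univ.erase i,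
      ∑ x, Q x * ∑ r : Fin n → Bool, (∏ k, reportProb (θ k) (r k) (x k)) * h (r j) (r i)) /
        ((n : ℝ) - 1) := by
    unfold expectedPay ppPayment
    rw [Finset.sum_comm, Finset.sum_div]
    refine Finset.sum_congr rfl fun x _ => ?_
    rw [← Finset.mul_sum, mul_div_assoc, Finset.sum_comm, Finset.sum_div]
    congr 1
    refine Finset.sum_congr rfl fun r _ => ?_
    rw [← Finset.mul_sum, mul_div_assoc]
  rw [e, Finset.sum_congr rfl fun j hj => H.pair_pay h θ (Finset.ne_of_mem_erase hj).symm]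
  rw [Finset.sum_comm, Finset.sum_div]
  refine Finset.sum_congr rfl fun s _ => ?_
  rw [← Finset.mul_sum, mul_div_assoc, Finset.sum_add_distrib, add_div, ← Finset.mul_sum,
    ← Finset.mul_sum, mul_div_assoc, mul_div_assoc, payFor_average H.two_le,
    payFor_average H.two_le]
  rfl

lemma PairLaw.wt_pos (H : PairLaw Q a b) (s : Bool) : 0 < wt a b s := by
  have h1 := H.b_pos
  have h2 := H.a_lt
  cases s <;> simp only [wt] <;> apply div_pos <;> linarith

lemma peerOne_update (θ : Fin n → Strategy) (i : Fin n) (θ' : Strategy) (s : Bool) :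
    peerOne a b (Function.update θ i θ') i s = peerOne a b θ i s := by
  unfold peerOne
  congr 1
  refine Finset.sum_congr rfl fun j hj => ?_
  rw [Function.update_of_ne (Finset.ne_of_mem_erase hj)]

lemma peerOne_const (hn : 2 ≤ n) (θ : Strategy) (i : Fin n) (s : Bool) :
    peerOne a b (fun _ => θ) i s = reportOne a b θ s :=
  sum_erase_const hn i _

lemma PairLaw.expectedPay_const (H : PairLaw Q a b) (h : Bool → Bool → ℝ) (θ : Strategy)
    (i : Fin n) : expectedPay Q (ppPayment h) (fun _ => θ) i = symPay a b h θ := by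
  rw [H.expectedPay_eq]
  simp only [peerOne_const H.two_le]
  rfl

lemma PairLaw.value_const (H : PairLaw Q a b) (h : Bool → Bool → ℝ) (θ : Strategy) :
    value Q h (fun _ => θ) = symPay a b h θ := by
  unfold value
  rw [Finset.sum_congr rfl fun i _ => H.expectedPay_const h θ i]
  have : (n : ℝ) ≠ 0 := by have := H.two_le; positivity
  simp [this]

/-- A deviation does not affect `peerOne`, and both signals have positive weight, so optimality can
be checked signal by signal. -/
lemma PairLaw.isEquilibrium_iff (H : PairLaw Q a b) (h : Bool → Bool → ℝ)
    (θ : Fin n → Strategy) : IsEquilibrium Q (ppPayment h) θ ↔ ∀ i s,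
      (payFor h false (peerOne a b θ i s) < payFor h true (peerOne a b θ i s) → θ i s = 1) ∧
      (payFor h true (peerOne a b θ i s) < payFor h false (peerOne a b θ i s) → θ i s = 0) := by
  constructor
  · intro E i s
    have dev : ∀ t : unitInterval,
        (t : ℝ) * payFor h true (peerOne a b θ i s) +
          (1 - t) * payFor h false (peerOne a b θ i s) ≤
        θ i s * payFor h true (peerOne a b θ i s) +
          (1 - θ i s) * payFor h false (peerOne a b θ i s) := by
      intro t
      -- Deviating at the signal s alone isolates its term of the payoff.
      have := E i (Function.update (θ i) s t)
      rw [H.expectedPay_eq, H.expectedPay_eq] at this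
      simp only [peerOne_update, Function.update_self, Fintype.sum_bool] at this
      cases s <;>
        simp only [Function.update_self, ne_eq, Bool.true_eq_false, Bool.false_eq_true,
          not_false_eq_true, Function.update_of_ne] at this
      · exact le_of_mul_le_mul_left (by linarith) (H.wt_pos false)
      · exact le_of_mul_le_mul_left (by linarith) (H.wt_pos true)
    constructor
    · intro hlt
      have d := dev 1
      have h1 := (θ i s).2.2
      refine Subtype.ext (le_antisymm h1 ?_)
      simp only [Set.Icc.coe_one] at d ⊢
      by_contra hc
      push Not at hc
      nlinarith [mul_pos (sub_pos.2 hc) (sub_pos.2 hlt)]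
    · intro hlt
      have d := dev 0
      have h1 := (θ i s).2.1
      refine Subtype.ext (le_antisymm ?_ h1)
      simp only [Set.Icc.coe_zero] at d ⊢
      by_contra hc
      push Not at hc
      nlinarith [mul_pos hc (sub_pos.2 hlt)]
  · intro E i θ'
    rw [H.expectedPay_eq, H.expectedPay_eq]
    simp only [peerOne_update, Function.update_self]
    refine Finset.sum_le_sum fun s _ => mul_le_mul_of_nonneg_left ?_ (H.wt_pos s).le
    have t0 := (θ' s).2.1
    have t1 := (θ' s).2.2
    rcases lt_trichotomy (payFor h false (peerOne a b θ i s)) (payFor h true (peerOne a b θ i s))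
      with hlt | heq | hlt
    · rw [(E i s).1 hlt]
      simp only [Set.Icc.coe_one]
      nlinarith [mul_nonneg (sub_nonneg.2 t1) (sub_pos.2 hlt).le]
    · rw [heq]; linarith
    · rw [(E i s).2 hlt]
      simp only [Set.Icc.coe_zero]
      nlinarith [mul_nonneg t0 (sub_pos.2 hlt).le]

lemma peerOne_sub (θ : Fin n → Strategy) (i k : Fin n) (s : Bool) :
    peerOne a b θ k s - peerOne a b θ i s =
      (reportOne a b (θ i) s - reportOne a b (θ k) s) / ((n : ℝ) - 1) := by
  unfold peerOne
  rw [← sub_div]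
  congr 1
  rw [Finset.sum_erase_eq_sub (Finset.mem_univ _), Finset.sum_erase_eq_sub (Finset.mem_univ _)]
  ring

/-- In an equilibrium all agents play the same strategy. -/
lemma PairLaw.isEquilibrium_symmetric (H : PairLaw Q a b) {h : Bool → Bool → ℝ}
    (hh : Admissible a b h) {θ : Fin n → Strategy} (E : IsEquilibrium Q (ppPayment h) θ)
    (i k : Fin n) : θ i = θ k := by
  rw [H.isEquilibrium_iff] at E
  obtain ⟨x, y, t, hx, hy, hq, hK, -⟩ := hh.normalForm H.b_lt
  have hdiff : ∀ p, payFor h true p - payFor h false p = (x + y) * (p - t) := by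
    intro p; unfold payFor; rw [hx, hy] at *; linarith
  have hn1 : (0 : ℝ) < (n : ℝ) - 1 := by
    have : (2 : ℝ) ≤ n := by exact_mod_cast H.two_le
    linarith
  -- an agent who reports `1` more often on some signal faces peers who do so at least as often
  have mono : ∀ i k s, i ≠ k → (θ k s : ℝ) < θ i s →
      reportOne a b (θ i) s ≤ reportOne a b (θ k) s := by
    intro i k s hik hlt
    by_contra hc
    push Not at hc
    have h1 : peerOne a b θ i s < peerOne a b θ k s := by
      have := peerOne_sub (a := a) (b := b) θ i k s
      have h2 : 0 < (reportOne a b (θ i) s - reportOne a b (θ k) s) / ((n : ℝ) - 1) :=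
        div_pos (by linarith) hn1
      linarith
    have hi := (θ i s).2.1
    have hi1 := (θ i s).2.2
    have hk := (θ k s).2.1
    by_cases hp : peerOne a b θ i s < t
    · have : payFor h true (peerOne a b θ i s) < payFor h false (peerOne a b θ i s) := by
        have := hdiff (peerOne a b θ i s)
        nlinarith [mul_pos hK (sub_pos.2 hp)]
      have := congrArg Subtype.val ((E i s).2 this)
      simp only [Set.Icc.coe_zero] at this
      linarith
    · have : payFor h false (peerOne a b θ k s) < payFor h true (peerOne a b θ k s) := by
        have := hdiff (peerOne a b θ k s)
        push Not at hp
        nlinarith [mul_pos hK (sub_pos.2 (hp.trans_lt h1))]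
      have := congrArg Subtype.val ((E k s).1 this)
      simp only [Set.Icc.coe_one] at this
      linarith
  have b0 := H.b_pos
  have b1 := H.b_lt
  have b2 := H.a_lt
  by_contra hne
  have hik : i ≠ k := fun e => hne (by rw [e])
  have m1 := mono i k true hik
  have m2 := mono k i true hik.symm
  have m3 := mono i k false hik
  have m4 := mono k i false hik.symm
  simp only [reportOne, cc] at m1 m2 m3 m4
  apply hne
  set u := (θ i true : ℝ)
  set v := (θ k true : ℝ)
  set u' := (θ i false : ℝ)
  set v' := (θ k false : ℝ)
  have A0 : 0 < 1 - a := by linarith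
  have B0 : 0 < 1 - b := by linarith
  have a0 : 0 < a := by linarith
  -- If two strategies differ in the same direction on both signals, `mono` fails at once. If they
  -- differ in opposite directions, the two inequalities from `mono` contradict the positivity of
  -- this determinant, which is a - b.
  have det : 0 < a * (1 - b) - b * (1 - a) := by linarith
  have hu : u' = v' ∧ u = v := by
    rcases lt_trichotomy u v with h1 | h1 | h1 <;> rcases lt_trichotomy u' v' with h2 | h2 | h2
    · have := m2 h1; nlinarith
    · have := m2 h1; nlinarith
    · have e1 := m2 h1
      have e2 := m3 h2
      have e1' : a * (v - u) ≤ (1 - a) * (u' - v') := by linarith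
      have e2' : (1 - b) * (u' - v') ≤ b * (v - u) := by linarith
      nlinarith [mul_le_mul_of_nonneg_left e1' B0.le, mul_le_mul_of_nonneg_left e2' A0.le]
    · have := m4 h2; nlinarith
    · exact ⟨h2, h1⟩
    · have := m3 h2; nlinarith
    · have e1 := m1 h1
      have e2 := m4 h2
      have e1' : a * (u - v) ≤ (1 - a) * (v' - u') := by linarith
      have e2' : (1 - b) * (v' - u') ≤ b * (u - v) := by linarith
      nlinarith [mul_le_mul_of_nonneg_left e1' B0.le, mul_le_mul_of_nonneg_left e2' A0.le]
    · have := m1 h1; nlinarith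
    · have := m1 h1; nlinarith
  exact strategy_ext hu.1 hu.2

lemma PairLaw.isEquilibrium_const_iff (H : PairLaw Q a b) (h : Bool → Bool → ℝ) (θ : Strategy) :
    IsEquilibrium Q (ppPayment h) (fun _ => θ) ↔ SymEq a b h θ := by
  rw [H.isEquilibrium_iff]
  simp only [peerOne_const H.two_le]
  exact ⟨fun E => E ⟨0, by have := H.two_le; omega⟩, fun E _ => E⟩

lemma PairLaw.exists_of_isEquilibrium (H : PairLaw Q a b) {h : Bool → Bool → ℝ}
    (hh : Admissible a b h) {θ : Fin n → Strategy} (E : IsEquilibrium Q (ppPayment h) θ) :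
    ∃ θ₀, SymEq a b h θ₀ ∧ θ = fun _ => θ₀ := by
  have e : θ = fun _ => θ ⟨0, by have := H.two_le; omega⟩ :=
    funext fun i => H.isEquilibrium_symmetric hh E _ _
  refine ⟨_, ?_, e⟩
  rw [← H.isEquilibrium_const_iff, ← e]
  exact E

lemma truth_eq : truth n = fun _ => honest := rfl

lemma const_injective (hn : 2 ≤ n) {θ θ' : Strategy} :
    ((fun _ => θ : Fin n → Strategy) = fun _ => θ') ↔ θ = θ' :=
  ⟨fun e => congrFun e ⟨0, by omega⟩, fun e => by rw [e]⟩

lemma PairLaw.otherInformative_eq (H : PairLaw Q a b) {h : Bool → Bool → ℝ}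
    (hh : Admissible a b h) : otherInformative Q (ppPayment h) =
      (fun θ _ => θ) '' symOthers a b h := by
  ext θ
  constructor
  · rintro ⟨h1, h2, h3, h4⟩
    obtain ⟨θ₀, e, rfl⟩ := H.exists_of_isEquilibrium hh h1
    refine ⟨θ₀, ⟨e, fun e => h2 ?_, fun e => h3 ?_, fun e => h4 ?_⟩, rfl⟩ <;> rw [e] <;> rfl
  · rintro ⟨θ₀, ⟨h1, h2, h3, h4⟩, rfl⟩
    refine ⟨(H.isEquilibrium_const_iff h θ₀).2 h1, fun e => h2 ?_, fun e => h3 ?_, fun e => h4 ?_⟩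
    · exact (const_injective H.two_le).1 e
    · exact (const_injective H.two_le).1 e
    · exact (const_injective H.two_le).1 e

lemma PairLaw.gap_eq (H : PairLaw Q a b) {h : Bool → Bool → ℝ} (hh : Admissible a b h) :
    gap Q h = symGap a b h := by
  unfold gap symGap
  rw [truth_eq, H.value_const, H.otherInformative_eq hh, Set.image_image]
  simp only [H.value_const]

/-! #### The matrices of peer-prediction mechanisms -/

/-- A strictly proper scoring rule for a matrix for which truth-telling is strict: the tangents of
the larger one of two parabolas of curvature `2 * c` which touch the payoffs of the reports. -/
lemma exists_isStrictlyProper {h : Bool → Bool → ℝ} (hab : b < a)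
    (h1 : payFor h false a < payFor h true a) (h2 : payFor h true b < payFor h false b) :
    ∃ PS, IsStrictlyProper PS ∧ ∀ j, PS j a = h j true ∧ PS j b = h j false := by
  classical
  have hd : 0 < (a - b) ^ 2 := by have := sub_pos.2 hab; positivity
  -- The curvature is small enough that the parabola of report 1 is still on top at a and that of
  -- report 0 at b.
  set c := min (payFor h true a - payFor h false a) (payFor h false b - payFor h true b) /
    (2 * (a - b) ^ 2) with hc
  have hmin : 0 < min (payFor h true a - payFor h false a)
      (payFor h false b - payFor h true b) := lt_min (by linarith) (by linarith)
  have c0 : 0 < c := by positivity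
  have hcd : c * (a - b) ^ 2 < min (payFor h true a - payFor h false a)
      (payFor h false b - payFor h true b) := by
    have : c * (a - b) ^ 2 = min (payFor h true a - payFor h false a)
      (payFor h false b - payFor h true b) / 2 := by rw [hc]; field_simp [(sub_pos.2 hab).ne']
    linarith
  have d1 := hcd.trans_le (min_le_left _ _)
  have d2 := hcd.trans_le (min_le_right _ _)
  set g : Bool → ℝ → ℝ := fun u p => payFor h u p + c * (p - if u then a else b) ^ 2 with hg
  set sel : ℝ → Bool := fun y => decide (g false y ≤ g true y) with hsel
  set e : Bool → ℝ := fun u => if u then a else b with he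
  set v : Bool → ℝ := fun j => if j then 1 else 0 with hv
  set PS : Bool → ℝ → ℝ := fun j y =>
    h j (sel y) + c * ((v j - e (sel y)) ^ 2 - (v j - y) ^ 2) with hPS
  -- The variance terms cancel, leaving the selected parabola minus a penalty c (p - y)². Since `sel
  -- p` selects the larger parabola at p, the honest prediction is the strict maximum.
  have hES : ∀ p y, expectedScore PS p y = g (sel y) p - c * (p - y) ^ 2 := by
    intro p y
    simp only [expectedScore, hPS, hg, payFor, hv, he]
    simp only [if_true, Bool.false_eq_true, if_false]
    ring
  have hmax : ∀ u p, g u p ≤ g (sel p) p := by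
    intro u p
    by_cases hp : g false p ≤ g true p
    · have : sel p = true := by simp [hsel, hp]
      rw [this]; cases u
      · exact hp
      · exact le_rfl
    · have : sel p = false := by simp [hsel, hp]
      rw [this]; cases u
      · exact le_rfl
      · exact (not_le.1 hp).le
  have sa : sel a = true := by
    simp only [hsel, hg, decide_eq_true_eq, if_true, Bool.false_eq_true, if_false, sub_self]
    linarith
  have sb : sel b = false := by
    have e : (b - a) ^ 2 = (a - b) ^ 2 := by ring
    simp only [hsel, hg, decide_eq_false_iff_not, not_le, if_true, Bool.false_eq_true, if_false,
      sub_self, e]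
    linarith
  refine ⟨PS, ?_, fun j => ⟨?_, ?_⟩⟩
  · intro p _ y _ hyp
    rw [hES, hES]
    have h3 : 0 < (p - y) ^ 2 := by
      have : p - y ≠ 0 := sub_ne_zero.2 hyp.symm
      positivity
    have := hmax (sel y) p
    have := mul_pos c0 h3
    rw [sub_self]
    linarith
  · simp [hPS, sa, he]
  · simp [hPS, sb, he]

lemma isLeast_range_iff (h : Bool → Bool → ℝ) (m : ℝ) :
    IsLeast (Set.range fun b : Bool × Bool => h b.1 b.2) m ↔
      (∃ i j, h i j = m) ∧ ∀ i j, m ≤ h i j := by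
  constructor
  · rintro ⟨⟨⟨i, j⟩, h1⟩, h2⟩
    exact ⟨⟨i, j, h1⟩, fun i j => h2 ⟨(i, j), rfl⟩⟩
  · rintro ⟨⟨i, j, h1⟩, h2⟩
    exact ⟨⟨(i, j), h1⟩, by rintro _ ⟨⟨i, j⟩, rfl⟩; exact h2 i j⟩

lemma isGreatest_range_iff (h : Bool → Bool → ℝ) (m : ℝ) :
    IsGreatest (Set.range fun b : Bool × Bool => h b.1 b.2) m ↔
      (∃ i j, h i j = m) ∧ ∀ i j, h i j ≤ m := by
  constructor
  · rintro ⟨⟨⟨i, j⟩, h1⟩, h2⟩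
    exact ⟨⟨i, j, h1⟩, fun i j => h2 ⟨(i, j), rfl⟩⟩
  · rintro ⟨⟨i, j, h1⟩, h2⟩
    exact ⟨⟨(i, j), h1⟩, by rintro _ ⟨⟨i, j⟩, rfl⟩; exact h2 i j⟩

/-- The matrix uses the scoring rule only at the predictions a and b, where properness yields two
strict inequalities. Conversely, `exists_isStrictlyProper` interpolates any matrix satisfying these.
-/
lemma mem_unitMechanisms_iff (hb : 0 < b) (hab : b < a) (ha : a < 1) (hc : qc Q = cc a b)
    (h : Bool → Bool → ℝ) : h ∈ unitMechanisms Q ↔ Admissible a b h := by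
  unfold unitMechanisms Admissible
  rw [Set.mem_ofPred_eq, isLeast_range_iff, isGreatest_range_iff]
  have ca : qc Q true true = a := by rw [hc]; rfl
  have cb : qc Q true false = b := by rw [hc]; rfl
  constructor
  · rintro ⟨⟨PS, hPS, rfl⟩, ⟨h1, h2⟩, h3, h4⟩
    refine ⟨fun i j => ⟨h2 i j, h4 i j⟩, h1, h3, ?_, ?_⟩
    · have := hPS a ⟨by linarith, ha.le⟩ b ⟨hb.le, by linarith⟩ hab.ne
      simpa only [payFor, payoffMatrix, ca, cb, expectedScore] using this
    · have := hPS b ⟨hb.le, by linarith⟩ a ⟨by linarith, ha.le⟩ hab.ne'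
      simpa only [payFor, payoffMatrix, ca, cb, expectedScore] using this
  · rintro ⟨h1, h2, h3, h4, h5⟩
    obtain ⟨PS, hPS, e⟩ := exists_isStrictlyProper hab h4 h5
    refine ⟨⟨PS, hPS, ?_⟩, ⟨h2, fun i j => (h1 i j).1⟩, h3, fun i j => (h1 i j).2⟩
    funext j i
    cases i
    · simp only [payoffMatrix, cb, (e j).2]
    · simp only [payoffMatrix, ca, (e j).1]

lemma PairLaw.optGap_eq (H : PairLaw Q a b) (hc : qc Q = cc a b) : optGap Q = symOpt a b := by
  unfold optGap symOpt
  have e : unitMechanisms Q = {h | Admissible a b h} :=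
    Set.ext fun h => mem_unitMechanisms_iff H.b_pos H.b_lt H.a_lt hc h
  rw [e]
  congr 1
  exact Set.image_congr fun h hh => H.gap_eq hh

lemma PairLaw.isAttainable_iff (H : PairLaw Q a b) (hc : qc Q = cc a b) :
    IsAttainable Q ↔ SymAttainable a b := by
  unfold IsAttainable SymAttainable
  rw [H.optGap_eq hc]
  refine exists_congr fun h => ?_
  rw [mem_unitMechanisms_iff H.b_pos H.b_lt H.a_lt hc]
  exact and_congr_right fun hh => by rw [H.gap_eq hh]

end

noncomputable section

/-! ### Truth-telling with and without the punishment -/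

lemma Admissible.symEq_honest {a b : ℝ} {h : Bool → Bool → ℝ} (hh : Admissible a b h) :
    SymEq a b h honest := by
  obtain ⟨-, -, -, h1, h2⟩ := hh
  intro s
  cases s
  · have e : reportOne a b honest false = b := by simp [reportOne, honest, cc]
    rw [e]
    exact ⟨fun h => absurd h h2.not_gt, fun _ => rfl⟩
  · have e : reportOne a b honest true = a := by simp [reportOne, honest, cc]
    rw [e]
    exact ⟨fun _ => rfl, fun h => absurd h h1.not_gt⟩

lemma symGap_le {a b : ℝ} {h : Bool → Bool → ℝ} (hb : 0 < b) (hab : b ≤ a) (ha : a ≤ 1)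
    (hh : Admissible a b h) {θ : Strategy} (hθ : θ ∈ symOthers a b h) :
    symGap a b h ≤ symPay a b h honest - symPay a b h θ :=
  sub_le_sub_left (le_csSup (bddAbove_symPay hb hab ha hh.1 _) ⟨θ, hθ, rfl⟩) _

variable {n : ℕ} {Q : (Fin n → Bool) → ℝ} {a b : ℝ}

lemma PairLaw.isTruthBestInformative (H : PairLaw Q a b) {h : Bool → Bool → ℝ}
    (hh : Admissible a b h) (hg : 0 < symGap a b h) :
    IsTruthBestInformative Q (ppPayment h) := by
  refine ⟨(H.isEquilibrium_const_iff h honest).2 hh.symEq_honest, ?_⟩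
  rw [H.otherInformative_eq hh, truth_eq]
  rintro _ ⟨θ, hθ, rfl⟩ i
  rw [H.expectedPay_const, H.expectedPay_const]
  have := symGap_le H.b_pos H.b_lt.le H.a_lt.le hh hθ
  linarith

open Classical in
/-- Probability that all agents but `i` make the same report. -/
def sameProb (Q : (Fin n → Bool) → ℝ) (θ : Fin n → Strategy) (i : Fin n) : ℝ :=
  ∑ x, Q x * ∑ r : Fin n → Bool, (∏ k, reportProb (θ k) (r k) (x k)) *
    if ∃ b, ∀ j, j ≠ i → r j = b then 1 else 0

lemma expectedPay_punished (h : Bool → Bool → ℝ) (p : ℝ) (θ : Fin n → Strategy) (i : Fin n) :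
    expectedPay Q (punishedPayment h p) θ i =
      expectedPay Q (ppPayment h) θ i - p * sameProb Q θ i := by
  unfold expectedPay sameProb punishedPayment
  rw [Finset.mul_sum, ← Finset.sum_sub_distrib]
  refine Finset.sum_congr rfl fun x _ => ?_
  rw [mul_left_comm, Finset.mul_sum _ _ p, ← mul_sub, ← Finset.sum_sub_distrib]
  congr 1
  refine Finset.sum_congr rfl fun r _ => ?_
  split_ifs <;> ring

/-- Pair each report vector with the one flipped at i: the factors of agent i in a pair sum to 1 and
g takes the same value on both. The right side counts every pair twice, hence the division by 2. It
no longer involves the strategy of i. -/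
lemma sum_prod_eq_of_invariant (f : Fin n → Bool → ℝ) (i : Fin n) (hf : f i true + f i false = 1)
    (g : (Fin n → Bool) → ℝ) (hg : ∀ r u, g (Function.update r i u) = g r) :
    ∑ r : Fin n → Bool, (∏ k, f k (r k)) * g r =
      (∑ r : Fin n → Bool, (∏ k ∈ Finset.univ.erase i, f k (r k)) * g r) / 2 := by
  set e : Equiv.Perm (Fin n → Bool) :=
    Function.Involutive.toPerm (fun r => Function.update r i (!r i))
      (fun r => by simp)
  have he : ∀ r, e r = Function.update r i (!r i) := fun _ => rfl
  have h1 : ∑ r : Fin n → Bool, (∏ k, f k (r k)) * g r =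
      ∑ r : Fin n → Bool, (∏ k, f k (e r k)) * g (e r) :=
    (Equiv.sum_comp e (fun r => (∏ k, f k (r k)) * g r)).symm
  have h2 : ∑ r : Fin n → Bool, ((∏ k, f k (r k)) * g r + (∏ k, f k (e r k)) * g (e r)) =
      ∑ r : Fin n → Bool, (∏ k ∈ Finset.univ.erase i, f k (r k)) * g r := by
    refine Finset.sum_congr rfl fun r _ => ?_
    have e1 : g (e r) = g r := hg r _
    have e2 : ∏ k ∈ Finset.univ.erase i, f k (e r k) =
        ∏ k ∈ Finset.univ.erase i, f k (r k) := by
      refine Finset.prod_congr rfl fun k hk => ?_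
      rw [he, Function.update_of_ne (Finset.ne_of_mem_erase hk)]
    rw [e1, ← Finset.mul_prod_erase Finset.univ _ (Finset.mem_univ i),
      ← Finset.mul_prod_erase Finset.univ (fun k => f k (e r k)) (Finset.mem_univ i), e2]
    have e3 : f i (r i) + f i (e r i) = 1 := by
      have : e r i = !r i := by simp [he]
      rw [this]
      cases r i
      · simpa [add_comm] using hf
      · simpa using hf
    rw [← add_mul, ← add_mul, e3, one_mul]
  rw [Finset.sum_add_distrib, ← h1] at h2
  linarith

lemma sameProb_update (θ : Fin n → Strategy) (i : Fin n) (θ' : Strategy) :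
    sameProb Q (Function.update θ i θ') i = sameProb Q θ i := by
  classical
  unfold sameProb
  refine Finset.sum_congr rfl fun x _ => ?_
  congr 1
  have hg : ∀ (r : Fin n → Bool) (u : Bool),
      (if ∃ b, ∀ j, j ≠ i → Function.update r i u j = b then (1 : ℝ) else 0) =
        if ∃ b, ∀ j, j ≠ i → r j = b then 1 else 0 := by
    intro r u
    have : (∃ b, ∀ j, j ≠ i → Function.update r i u j = b) ↔ ∃ b, ∀ j, j ≠ i → r j = b :=
      exists_congr fun b => forall_congr' fun j => by
        refine imp_congr_right fun hj => ?_
        rw [Function.update_of_ne hj]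
    simp only [this]
  have hs : ∀ (θ : Strategy) (s : Bool), reportProb θ true s + reportProb θ false s = 1 := by
    intro θ s; simp [reportProb]
  rw [sum_prod_eq_of_invariant (fun k u => reportProb (Function.update θ i θ' k) u (x k)) i
      (hs _ _) _ hg,
    sum_prod_eq_of_invariant (fun k u => reportProb (θ k) u (x k)) i (hs _ _) _ hg]
  congr 1
  refine Finset.sum_congr rfl fun r _ => ?_
  congr 1
  refine Finset.prod_congr rfl fun k hk => ?_
  rw [Function.update_of_ne (Finset.ne_of_mem_erase hk)]

/-- By `sameProb_update`, the expected punishment of an agent does not depend on her own strategy,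
so it cancels from every deviation. -/
lemma isEquilibrium_punished_iff (h : Bool → Bool → ℝ) (p : ℝ) (θ : Fin n → Strategy) :
    IsEquilibrium Q (punishedPayment h p) θ ↔ IsEquilibrium Q (ppPayment h) θ := by
  refine forall_congr' fun i => forall_congr' fun θ' => ?_
  rw [expectedPay_punished, expectedPay_punished, sameProb_update, sub_le_sub_iff_right]

lemma reportProb_nonneg (θ : Strategy) (u s : Bool) : 0 ≤ reportProb θ u s := by
  have t0 := (θ s).2.1
  have t1 := (θ s).2.2
  unfold reportProb
  split_ifs
  · exact t0
  · linarith

lemma sameProb_nonneg (hQ : ∀ x, 0 ≤ Q x) (θ : Fin n → Strategy) (i : Fin n) :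
    0 ≤ sameProb Q θ i := by
  refine Finset.sum_nonneg fun x _ => mul_nonneg (hQ x) (Finset.sum_nonneg fun r _ =>
    mul_nonneg (Finset.prod_nonneg fun k _ => reportProb_nonneg _ _ _) ?_)
  split_ifs <;> norm_num

/-- For a deterministic strategy `σ`, the reports are `σ` applied to the signals. -/
lemma sum_prod_reportProb_pure {θ : Strategy} {σ : Bool → Bool}
    (hθ : ∀ s, θ s = if σ s then 1 else 0) (x : Fin n → Bool) (g : (Fin n → Bool) → ℝ) :
    ∑ r : Fin n → Bool, (∏ k, reportProb θ (r k) (x k)) * g r = g (fun k => σ (x k)) := by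
  have e : ∀ u s, reportProb θ u s = if u = σ s then 1 else 0 := by
    intro u s
    rw [reportProb, hθ]
    cases u <;> cases σ s <;> simp
  simp only [e]
  rw [Finset.sum_eq_single (fun k => σ (x k))]
  · simp
  · intro r _ hr
    obtain ⟨k, hk⟩ := Function.ne_iff.1 hr
    rw [Finset.prod_eq_zero (Finset.mem_univ k) (by simp [hk]), zero_mul]
  · simp

lemma sameProb_const (hQ : ∑ x, Q x = 1) {θ : Strategy} {u : Bool}
    (hθ : ∀ s, θ s = if u then 1 else 0) (i : Fin n) : sameProb Q (fun _ => θ) i = 1 := by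
  classical
  refine Eq.trans ?_ hQ
  refine Finset.sum_congr rfl fun x _ => ?_
  rw [sum_prod_reportProb_pure (σ := fun _ => u) hθ x, if_pos ⟨u, fun _ _ => rfl⟩, mul_one]

lemma sameProb_honest_le (i : Fin n) : sameProb Q (fun _ => honest) i ≤ epsQ Q := by
  classical
  have e : sameProb Q (fun _ => honest) i = prob Q {x | ∃ b, ∀ j, j ≠ i → x j = b} := by
    unfold sameProb prob
    refine Finset.sum_congr rfl fun x _ => ?_
    rw [sum_prod_reportProb_pure (θ := honest) (σ := fun s => s) (fun s => rfl) x]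
    by_cases hx : ∃ b, ∀ j, j ≠ i → x j = b
    · rw [if_pos hx, mul_one, Set.indicator_of_mem (by exact hx)]
    · rw [if_neg hx, mul_zero, Set.indicator_of_notMem (by exact hx)]
  rw [e]
  exact le_ciSup (f := fun i : Fin n => prob Q {x | ∃ b, ∀ j, j ≠ i → x j = b})
    (Set.finite_range _).bddAbove i

/-- Truth-telling is focal if the punishment exceeds what the uninformative equilibria may gain,
and its expected value under truth-telling is below the gap. -/
lemma PairLaw.isFocal_punished (H : PairLaw Q a b) {h : Bool → Bool → ℝ}
    (hh : Admissible a b h) {p : ℝ} (hp : 0 ≤ p) (hgap : p * epsQ Q < symGap a b h)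
    (hpay : 1 - p < symPay a b h honest - p * epsQ Q) :
    IsFocal Q (punishedPayment h p) (truth n) := by
  refine ⟨?_, ?_⟩
  · rw [isEquilibrium_punished_iff]
    exact (H.isEquilibrium_const_iff h honest).2 hh.symEq_honest
  · intro θ' E hne i
    rw [isEquilibrium_punished_iff] at E
    obtain ⟨θ, hθ, rfl⟩ := H.exists_of_isEquilibrium hh E
    rw [truth_eq, expectedPay_punished, expectedPay_punished, H.expectedPay_const,
      H.expectedPay_const]
    have hT := mul_le_mul_of_nonneg_left (sameProb_honest_le (Q := Q) i) hp
    have h1 := (symPay_mem H.b_pos H.b_lt.le H.a_lt.le hh.1 θ).2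
    have hneT : θ ≠ honest := fun e => hne (by rw [e]; rfl)
    by_cases h0 : θ = fun _ => 0
    · have := sameProb_const H.total (θ := θ) (u := false) (by rw [h0]; intro s; simp) i
      rw [this]; linarith
    by_cases h1' : θ = fun _ => 1
    · have := sameProb_const H.total (θ := θ) (u := true) (by rw [h1']; intro s; simp) i
      rw [this]; linarith
    have := symGap_le H.b_pos H.b_lt.le H.a_lt.le hh ⟨hθ, hneT, h0, h1'⟩
    have := mul_nonneg hp (sameProb_nonneg H.nonneg (fun _ => θ) i)
    linarith

end

noncomputable section

/-! ### The symmetric equilibria and their payoffs -/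

/-- `x` and `y` are the gains from reporting `1` resp. `0` to a peer who reports the same, and `q`
is the probability of the report `1` at which both reports pay the same. -/
structure HasForm (h : Bool → Bool → ℝ) (x y q : ℝ) : Prop where
  hx : x = h true true - h false true
  hy : y = h false false - h true false
  hq : q * (x + y) = h false false - h false true

variable {a b x y q : ℝ} {h : Bool → Bool → ℝ}

lemma HasForm.payFor_false (F : HasForm h x y q) (p : ℝ) :
    payFor h false p = h false false - y * p := by
  rw [F.hy, payFor]; ring

lemma HasForm.payFor_true (F : HasForm h x y q) (p : ℝ) :
    payFor h true p = h false false - y * p + (x + y) * (p - q) := by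
  have := F.hq
  have := F.hx
  have := F.hy
  have e : payFor h true p = h false true + p * (h true true - h false true) := by
    unfold payFor; ring
  rw [e, ← F.hx]
  linarith

lemma HasForm.symPay_eq (F : HasForm h x y q) (hD : 0 < b + (1 - a)) (θ : Strategy) :
    (b + (1 - a)) * symPay a b h θ =
      b * (h false false - y * (θ true * a + θ false * (1 - a)) +
        θ true * ((x + y) * (θ true * a + θ false * (1 - a) - q))) +
      (1 - a) * (h false false - y * (θ true * b + θ false * (1 - b)) +
        θ false * ((x + y) * (θ true * b + θ false * (1 - b) - q))) := by
  rw [PeerPrediction.symPay_eq, mul_div_cancel₀ _ hD.ne']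
  simp only [F.payFor_false, F.payFor_true]
  ring

lemma HasForm.symEq_iff (F : HasForm h x y q) (hK : 0 < x + y) (θ : Strategy) :
    SymEq a b h θ ↔
      ((q < θ true * b + θ false * (1 - b) → (θ false : ℝ) = 1) ∧
        (θ true * b + θ false * (1 - b) < q → (θ false : ℝ) = 0)) ∧
      ((q < θ true * a + θ false * (1 - a) → (θ true : ℝ) = 1) ∧
        (θ true * a + θ false * (1 - a) < q → (θ true : ℝ) = 0)) := by
  have e1 : ∀ p, payFor h false p < payFor h true p ↔ q < p := by
    intro p
    rw [F.payFor_false, F.payFor_true]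
    constructor
    · intro h
      by_contra hc
      nlinarith [mul_nonneg hK.le (sub_nonneg.2 (not_lt.1 hc))]
    · intro h
      nlinarith [mul_pos hK (sub_pos.2 h)]
  have e2 : ∀ p, payFor h true p < payFor h false p ↔ p < q := by
    intro p
    rw [F.payFor_false, F.payFor_true]
    constructor
    · intro h
      by_contra hc
      nlinarith [mul_nonneg hK.le (sub_nonneg.2 (not_lt.1 hc))]
    · intro h
      nlinarith [mul_pos hK (sub_pos.2 h)]
  simp only [SymEq, e1, e2, Bool.forall_bool, reportOne, cc, ← Set.Icc.coe_eq_one,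
    ← Set.Icc.coe_eq_zero]

/-- The payoff advantages of truth-telling over the other informative symmetric equilibria. -/
lemma HasForm.deficit (F : HasForm h x y q) (hK : 0 < x + y) (hb : 0 < b) (hbq : b < q)
    (hqa : q < a) (ha : a < 1) {θ : Strategy} (hθ : θ ∈ symOthers a b h) :
    let d := (b + (1 - a)) * (symPay a b h honest - symPay a b h θ)
    d * (1 - b) = (1 - a) * (q - b) * (y * (1 - b) - x * b) ∨
    d * a = b * (a - q) * (x * a - y * (1 - a)) ∨
    (q ≤ 1 - b ∧ d * (1 - b) =
      x * (b * (a - q) * (1 - b)) + y * ((1 - a) * (q - b) * (1 - b) - b * q * (a - b))) ∨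
    d * a = x * (b * (a - q) * a - (1 - a) * (1 - q) * (a - b)) + y * ((1 - a) * (q - b) * a) ∨
    d = x * b * (a - q) + y * (1 - a) * (q - b) ∨
    (q ≤ 1 - b ∧ d = (a + b - 1) * (x - q * (x + y))) := by
  intro d
  obtain ⟨hE, hne, hn0, hn1⟩ := hθ
  rw [F.symEq_iff hK] at hE
  have hD : 0 < b + (1 - a) := by linarith
  have B0 : 0 < 1 - b := by linarith
  have A0 : 0 < 1 - a := by linarith
  have a0 : 0 < a := by linarith
  have hd : d = b * (h false false - y * a + (x + y) * (a - q)) +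
      (1 - a) * (h false false - y * b) - (b + (1 - a)) * symPay a b h θ := by
    have := F.symPay_eq (a := a) hD honest
    simp only [honest, if_true, Bool.false_eq_true, if_false, Set.Icc.coe_one,
      Set.Icc.coe_zero] at this
    simp only [d, mul_sub]
    linarith
  rw [F.symPay_eq hD] at hd
  have n0 : ¬ ((θ true : ℝ) = 0 ∧ (θ false : ℝ) = 0) :=
    fun e => hn0 (strategy_ext (by simpa using e.2) (by simpa using e.1))
  have n1 : ¬ ((θ true : ℝ) = 1 ∧ (θ false : ℝ) = 1) :=
    fun e => hn1 (strategy_ext (by simpa using e.2) (by simpa using e.1))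
  have nT : ¬ ((θ true : ℝ) = 1 ∧ (θ false : ℝ) = 0) :=
    fun e => hne (strategy_ext (by simpa [honest] using e.2) (by simpa [honest] using e.1))
  have u0 := (θ true).2.1
  have u1 := (θ true).2.2
  have v0 := (θ false).2.1
  have v1 := (θ false).2.2
  clear_value d
  generalize (θ true : ℝ) = u at *
  generalize (θ false : ℝ) = v at *
  obtain ⟨⟨E1, E2⟩, E3, E4⟩ := hE
  -- Nine cases, by the optimal reports (0, indifferent or 1) on the signals 0 and 1. Three of them
  -- are the excluded profiles: all 0, truth, all 1. In the others the indifference equations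
  -- determine the strategy.
  rcases lt_trichotomy (u * b + v * (1 - b)) q with h0 | h0 | h0 <;>
    rcases lt_trichotomy (u * a + v * (1 - a)) q with h1 | h1 | h1
  · exact absurd ⟨E4 h1, E2 h0⟩ n0
  · have hv := E2 h0
    subst hv
    right; left
    have hu : u = q / a := by field_simp; linarith
    subst hu
    rw [hd]; field_simp; ring
  · exact absurd ⟨E3 h1, E2 h0⟩ nT
  · have hu := E4 h1
    subst hu
    right; right; left
    have hv : v = q / (1 - b) := by field_simp; linarith
    refine ⟨by rw [hv, div_le_one B0] at v1; exact v1, ?_⟩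
    subst hv
    rw [hd]; field_simp; ring
  · right; right; right; right; left
    have huv : (a - b) * (u - v) = 0 := by linarith
    have hu : u = v := by
      rcases mul_eq_zero.1 huv with h | h
      · exact absurd h (by intro h; linarith)
      · linarith
    subst hu
    have hq : u = q := by linarith
    subst hq
    rw [hd]; ring
  · have hu := E3 h1
    subst hu
    left
    have hv : v = (q - b) / (1 - b) := by field_simp; linarith
    subst hv
    rw [hd]; field_simp; ring
  · have hu := E4 h1
    have hv := E1 h0
    subst hu hv
    right; right; right; right; right
    refine ⟨by linarith, ?_⟩
    rw [hd]; ring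
  · have hv := E1 h0
    subst hv
    right; right; right; left
    have hu : u = (q - (1 - a)) / a := by field_simp; linarith
    subst hu
    rw [hd]; field_simp; ring
  · exact absurd ⟨E3 h1, E1 h0⟩ n1

/-- The equilibrium in which agents with signal `0` are indifferent and the others report `1`. -/
lemma HasForm.exists_mix_zero (F : HasForm h x y q) (hK : 0 < x + y) (hb : 0 < b) (hbq : b < q)
    (hqa : q < a) (ha : a < 1) : ∃ θ ∈ symOthers a b h,
      (b + (1 - a)) * (symPay a b h honest - symPay a b h θ) * (1 - b) =
        (1 - a) * (q - b) * (y * (1 - b) - x * b) := by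
  have hD : 0 < b + (1 - a) := by linarith
  have B0 : 0 < 1 - b := by linarith
  have v0 : 0 < (q - b) / (1 - b) := div_pos (by linarith) B0
  have v1 : (q - b) / (1 - b) < 1 := by rw [div_lt_one B0]; linarith
  have e0 : 1 * b + (q - b) / (1 - b) * (1 - b) = q := by field_simp; ring
  have e1 : q < 1 * a + (q - b) / (1 - b) * (1 - a) := by
    rw [← sub_pos]
    have : 1 * a + (q - b) / (1 - b) * (1 - a) - q = (1 - q) * (a - b) / (1 - b) := by
      field_simp; ring
    rw [this]
    exact div_pos (mul_pos (by linarith) (by linarith)) B0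
  set θ : Strategy := fun s => if s then 1 else ⟨(q - b) / (1 - b), v0.le, v1.le⟩ with hθ
  have t1 : (θ true : ℝ) = 1 := by simp [hθ]
  have t0 : (θ false : ℝ) = (q - b) / (1 - b) := by simp [hθ]
  refine ⟨θ, ⟨?_, ?_, ?_, ?_⟩, ?_⟩
  · rw [F.symEq_iff hK, t1, t0, e0]
    exact ⟨⟨fun h => absurd h (lt_irrefl _), fun h => absurd h (lt_irrefl _)⟩,
      fun _ => rfl, fun h => absurd h e1.not_gt⟩
  · intro e; rw [e] at t0; simp only [honest, Bool.false_eq_true, if_false, Set.Icc.coe_zero] at t0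
    linarith
  · intro e; rw [e] at t1; simp at t1
  · intro e; rw [e] at t0; simp only [Set.Icc.coe_one] at t0; linarith
  · rw [mul_sub (b + (1 - a)) (symPay a b h honest), F.symPay_eq hD, F.symPay_eq hD, t0, t1]
    simp only [honest, if_true, Bool.false_eq_true, if_false, Set.Icc.coe_one, Set.Icc.coe_zero]
    field_simp
    ring

/-- The equilibrium in which agents with signal `1` are indifferent and the others report `0`. -/
lemma HasForm.exists_mix_one (F : HasForm h x y q) (hK : 0 < x + y) (hb : 0 < b) (hbq : b < q)
    (hqa : q < a) (ha : a < 1) : ∃ θ ∈ symOthers a b h,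
      (b + (1 - a)) * (symPay a b h honest - symPay a b h θ) * a =
        b * (a - q) * (x * a - y * (1 - a)) := by
  have hD : 0 < b + (1 - a) := by linarith
  have a0 : 0 < a := by linarith
  have v0 : 0 < q / a := div_pos (by linarith) a0
  have v1 : q / a < 1 := by rw [div_lt_one a0]; linarith
  have e1 : q / a * a + 0 * (1 - a) = q := by field_simp; ring
  have e0 : q / a * b + 0 * (1 - b) < q := by
    have : q - (q / a * b + 0 * (1 - b)) = q * (a - b) / a := by field_simp; ring
    have : 0 < q * (a - b) / a := div_pos (mul_pos (by linarith) (by linarith)) a0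
    linarith
  set θ : Strategy := fun s => if s then ⟨q / a, v0.le, v1.le⟩ else 0 with hθ
  have t1 : (θ true : ℝ) = q / a := by simp [hθ]
  have t0 : (θ false : ℝ) = 0 := by simp [hθ]
  refine ⟨θ, ⟨?_, ?_, ?_, ?_⟩, ?_⟩
  · rw [F.symEq_iff hK, t1, t0, e1]
    exact ⟨⟨fun h => absurd h e0.not_gt, fun _ => rfl⟩,
      fun h => absurd h (lt_irrefl _), fun h => absurd h (lt_irrefl _)⟩
  · intro e; rw [e] at t1; simp only [honest, if_true, Set.Icc.coe_one] at t1
    linarith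
  · intro e; rw [e] at t1; simp only [Set.Icc.coe_zero] at t1; linarith
  · intro e; rw [e] at t0; simp at t0
  · rw [mul_sub, F.symPay_eq hD, F.symPay_eq hD, t0, t1]
    simp only [honest, if_true, Bool.false_eq_true, if_false, Set.Icc.coe_one, Set.Icc.coe_zero]
    field_simp
    ring

/-- The equilibrium in which everybody lies. -/
lemma HasForm.exists_lie (F : HasForm h x y q) (hK : 0 < x + y) (hbq : b < q)
    (ha : a < 1) (hw : 1 < a + b) (hqB : q ≤ 1 - b) : ∃ θ ∈ symOthers a b h,
      (b + (1 - a)) * (symPay a b h honest - symPay a b h θ) =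
        (a + b - 1) * (x - q * (x + y)) := by
  have hD : 0 < b + (1 - a) := by linarith
  set θ : Strategy := fun s => if s then 0 else 1 with hθ
  have t1 : (θ true : ℝ) = 0 := by simp [hθ]
  have t0 : (θ false : ℝ) = 1 := by simp [hθ]
  refine ⟨θ, ⟨?_, ?_, ?_, ?_⟩, ?_⟩
  · rw [F.symEq_iff hK, t1, t0]
    refine ⟨⟨fun _ => rfl, fun h => ?_⟩, fun h => ?_, fun _ => rfl⟩ <;> linarith
  · intro e; rw [e] at t1; simp [honest] at t1
  · intro e; rw [e] at t0; simp at t0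
  · intro e; rw [e] at t1; simp at t1
  · rw [mul_sub, F.symPay_eq hD, F.symPay_eq hD, t0, t1]
    simp only [honest, if_true, Bool.false_eq_true, if_false, Set.Icc.coe_one, Set.Icc.coe_zero]
    ring

/-- Upper bounds for the gap of an admissible matrix. -/
lemma Admissible.gap_bounds (hh : Admissible a b h) (hb : 0 < b) (hab : b < a) (ha : a < 1)
    (hw : 1 < a + b) : ∃ x y q : ℝ, 0 < x + y ∧ b < q ∧ q < a ∧
      x ≤ 1 ∧ y ≤ 1 ∧ q * (x + y) ≤ 1 ∧ (1 - q) * (x + y) ≤ 1 ∧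
      (b + (1 - a)) * symGap a b h * (1 - b) ≤ (1 - a) * (q - b) * (y * (1 - b) - x * b) ∧
      (b + (1 - a)) * symGap a b h * a ≤ b * (a - q) * (x * a - y * (1 - a)) ∧
      (q ≤ 1 - b → (b + (1 - a)) * symGap a b h ≤ (a + b - 1) * (x - q * (x + y))) := by
  obtain ⟨x, y, q, hx, hy, hq, hK, hbq, hqa, h1, h2, h3, h4⟩ := hh.normalForm hab
  have F : HasForm h x y q := ⟨hx, hy, hq⟩
  have hD : 0 ≤ b + (1 - a) := by linarith
  refine ⟨x, y, q, hK, hbq, hqa, h1, h2, h3, h4, ?_, ?_, fun hqB => ?_⟩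
  · obtain ⟨θ, hθ, e⟩ := F.exists_mix_zero hK hb hbq hqa ha
    rw [← e]
    exact mul_le_mul_of_nonneg_right (mul_le_mul_of_nonneg_left
      (symGap_le hb hab.le ha.le hh hθ) hD) (by linarith)
  · obtain ⟨θ, hθ, e⟩ := F.exists_mix_one hK hb hbq hqa ha
    rw [← e]
    exact mul_le_mul_of_nonneg_right (mul_le_mul_of_nonneg_left
      (symGap_le hb hab.le ha.le hh hθ) hD) (by linarith)
  · obtain ⟨θ, hθ, e⟩ := F.exists_lie hK hbq ha hw hqB
    rw [← e]
    exact mul_le_mul_of_nonneg_left (symGap_le hb hab.le ha.le hh hθ) hD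

/-- The gap of a matrix for which the best other equilibrium is the one in which agents with
signal `0` are indifferent and the others report `1`. -/
lemma HasForm.symGap_eq (F : HasForm h x y q) (hK : 0 < x + y) (hb : 0 < b) (hbq : b < q) (hqa : q < a) (ha : a < 1) (hw : 1 < a + b)
    (hx : 0 ≤ x) {Δ : ℝ}
    (hA : (b + (1 - a)) * Δ * (1 - b) = (1 - a) * (q - b) * (y * (1 - b) - x * b))
    (hB : (b + (1 - a)) * Δ * a ≤ b * (a - q) * (x * a - y * (1 - a)))
    (hC : q ≤ 1 - b → (b + (1 - a)) * Δ * (1 - b) ≤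
      x * (b * (a - q) * (1 - b)) + y * ((1 - a) * (q - b) * (1 - b) - b * q * (a - b)))
    (hL : q ≤ 1 - b → (b + (1 - a)) * Δ ≤ (a + b - 1) * (x - q * (x + y))) :
    symGap a b h = Δ := by
  have hD : 0 < b + (1 - a) := by linarith
  have B0 : 0 < 1 - b := by linarith
  have a0 : 0 < a := by linarith
  obtain ⟨θ, hθ, e⟩ := F.exists_mix_zero hK hb hbq hqa ha
  have hval : symPay a b h honest - symPay a b h θ = Δ :=
    mul_left_cancel₀ hD.ne' (mul_right_cancel₀ B0.ne' (e.trans hA.symm))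
  -- The deficit of this equilibrium is Δ, so it remains to see that no other deficit is smaller.
  have hG : IsGreatest (symPay a b h '' symOthers a b h) (symPay a b h θ) := by
    refine ⟨⟨θ, hθ, rfl⟩, ?_⟩
    rintro _ ⟨θ', hθ', rfl⟩
    have key : Δ ≤ symPay a b h honest - symPay a b h θ' := by
      refine le_of_mul_le_mul_left ?_ hD
      have hA' : (b + (1 - a)) * Δ = (1 - a) * (q - b) * (y * (1 - b) - x * b) / (1 - b) := by
        rw [← hA]; field_simp
      rcases F.deficit hK hb hbq hqa ha hθ' with h | h | ⟨hq, h⟩ | h | h | ⟨hq, h⟩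
      · refine le_of_mul_le_mul_right ?_ B0
        rw [h, hA]
      · refine le_of_mul_le_mul_right ?_ a0
        rw [h]; exact hB
      · refine le_of_mul_le_mul_right ?_ B0
        rw [h]; exact hC hq
      -- For this equilibrium and the next, with the report 1 on signal 0 or with both signals
      -- indifferent, the excess over Δ is, after clearing denominators, a nonnegative multiple of
      -- x.
      · refine le_of_mul_le_mul_right ?_ a0
        rw [h, hA', div_mul_eq_mul_div, div_le_iff₀ B0, ← sub_nonneg]
        have : 0 ≤ x * ((1 - q) * ((a - b) * (a + b - 1))) :=
          mul_nonneg hx (mul_nonneg (by linarith) (mul_nonneg (by linarith) (by linarith)))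
        refine this.trans_eq ?_
        ring
      · rw [h, hA', div_le_iff₀ B0, ← sub_nonneg]
        have : 0 ≤ x * (b * ((1 - q) * (a - b))) :=
          mul_nonneg hx (mul_nonneg hb.le (mul_nonneg (by linarith) (by linarith)))
        refine this.trans_eq ?_
        ring
      · rw [h]; exact hL hq
    linarith
  unfold symGap
  rw [hG.csSup_eq, hval]

end

noncomputable section

/-! ### Optimisation -/

variable {a b q q' x y z G Δ η : ℝ}

/-- Weighting `hA` by b(a - q) and `hB` by (1 - a)(q - b) makes the right sides depend on x and y
only through x + y, which is at most 1/q. A common factor a - b is cancelled. -/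
lemma bound_of_scale (hb : 0 < b) (hbq : b < q) (hqa : q < a) (ha : a < 1)
    (hS : q * (x + y) ≤ 1)
    (hA : G * (1 - b) ≤ (1 - a) * (q - b) * (y * (1 - b) - x * b))
    (hB : G * a ≤ b * (a - q) * (x * a - y * (1 - a))) :
    G * (q * (a * b - (a + b - 1) * q)) ≤ (1 - a) * b * ((q - b) * (a - q)) := by
  have h1 := mul_le_mul_of_nonneg_left hA (mul_pos hb (sub_pos.2 hqa)).le
  have h2 := mul_le_mul_of_nonneg_left hB (mul_pos (sub_pos.2 ha) (sub_pos.2 hbq)).le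
  have h0 : 0 ≤ (1 - a) * b * ((q - b) * (a - q)) :=
    mul_nonneg (mul_pos (sub_pos.2 ha) hb).le (mul_pos (sub_pos.2 hbq) (sub_pos.2 hqa)).le
  have h3 := mul_le_mul_of_nonneg_left hS h0
  have h4 : G * (a * b - (a + b - 1) * q) ≤ (1 - a) * b * ((q - b) * (a - q)) * (x + y) := by
    refine le_of_mul_le_mul_left ?_ (sub_pos.2 (hbq.trans hqa))
    linarith
  have h5 := mul_le_mul_of_nonneg_left h4 (hb.trans hbq).le
  linarith

/-- Weighting `hA` by a(a - q) and `hB` by (1 - a)(q - b) eliminates x; then y ≤ 1 is used. -/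
lemma bound_of_le_one (hbq : b < q) (hqa : q < a) (ha : a < 1) (ha0 : 0 < a) (hS : y ≤ 1)
    (hA : G * (1 - b) ≤ (1 - a) * (q - b) * (y * (1 - b) - x * b))
    (hB : G * a ≤ b * (a - q) * (x * a - y * (1 - a))) :
    G * (a * ((1 - b) * (a - q) + (1 - a) * (q - b))) ≤
      (1 - a) * (a - b) * ((q - b) * (a - q)) := by
  have h1 := mul_le_mul_of_nonneg_left hA (mul_pos ha0 (sub_pos.2 hqa)).le
  have h2 := mul_le_mul_of_nonneg_left hB (mul_pos (sub_pos.2 ha) (sub_pos.2 hbq)).le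
  have h0 : 0 ≤ (1 - a) * (a - b) * ((q - b) * (a - q)) :=
    mul_nonneg (mul_pos (sub_pos.2 ha) (sub_pos.2 (hbq.trans hqa))).le
      (mul_pos (sub_pos.2 hbq) (sub_pos.2 hqa)).le
  have h3 := mul_le_mul_of_nonneg_left hS h0
  linarith

/-- The bound of `bound_of_scale` is decreasing in `q` to the right of the critical point. -/
lemma scale_bound_anti (hb : 0 < b) (hbq : b < q') (hqq : q' < q) (hqa : q < a) (ha : a < 1)
    (hcrit : b * (1 - b) * (a - q') ^ 2 ≤ a * (1 - a) * (q' - b) ^ 2) :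
    (q - b) * (a - q) * (q' * (a * b - (a + b - 1) * q')) <
      (q' - b) * (a - q') * (q * (a * b - (a + b - 1) * q)) := by
  have hba : b < a := by linarith
  -- The sign of the difference quotient of the bound: the cross-multiplied difference, times a - b,
  -- is q - q' times the gap in this inequality. The hypothesis is the same comparison without the
  -- extra factors b < a, so it holds with room to spare.
  have k1 : b * (b * (1 - b) * ((a - q) * (a - q'))) < a * (a * (1 - a) * ((q - b) * (q' - b))) := by
    have e1 : b * (1 - b) * ((a - q) * (a - q')) ≤ b * (1 - b) * (a - q') ^ 2 := by
      refine mul_le_mul_of_nonneg_left ?_ (mul_pos hb (by linarith)).le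
      nlinarith
    have e2 : a * (1 - a) * (q' - b) ^ 2 ≤ a * (1 - a) * ((q - b) * (q' - b)) := by
      refine mul_le_mul_of_nonneg_left ?_ (mul_pos (by linarith) (by linarith)).le
      nlinarith
    have e3 : 0 < a * (1 - a) * ((q - b) * (q' - b)) :=
      mul_pos (mul_pos (by linarith) (by linarith)) (mul_pos (by linarith) (by linarith))
    calc b * (b * (1 - b) * ((a - q) * (a - q')))
        ≤ b * (a * (1 - a) * ((q - b) * (q' - b))) :=
          mul_le_mul_of_nonneg_left (e1.trans (hcrit.trans e2)) hb.le
      _ < _ := mul_lt_mul_of_pos_right hba e3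
  have k2 := mul_pos (sub_pos.2 hqq) (sub_pos.2 k1)
  refine lt_of_mul_lt_mul_left ?_ (sub_pos.2 hba).le
  rw [← sub_pos]
  refine k2.trans_eq ?_
  ring

/-- The reciprocal of the bound of `bound_of_le_one` is, up to a constant, (1 - b)/(q - b) + (1 -
a)/(a - q). It still decreases up to the point fixed by `hcrit`, where this bound crosses that of
`bound_of_scale`. -/
lemma le_one_bound_mono (hb : 0 < b) (hbq : b < q) (hqq : q ≤ q') (hqa : q' < a) (ha : a < 1)
    (hcrit : a * (1 - a) * (q' - b) ^ 2 = b * (1 - b) * (a - q') ^ 2) :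
    (q - b) * (a - q) * ((1 - b) * (a - q') + (1 - a) * (q' - b)) ≤
      (q' - b) * (a - q') * ((1 - b) * (a - q) + (1 - a) * (q - b)) := by
  have a0 : 0 < a := by linarith
  have k1 : (1 - a) * ((q - b) * (q' - b)) ≤ (1 - b) * ((a - q) * (a - q')) := by
    refine le_of_mul_le_mul_left ?_ a0
    have e1 : (a - q') ^ 2 ≤ (a - q) * (a - q') := by nlinarith
    have e2 : (q - b) * (q' - b) ≤ (q' - b) ^ 2 := by nlinarith
    have e3 : 0 ≤ (a - q) * (a - q') := mul_nonneg (by linarith) (by linarith)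
    have B0 : 0 < 1 - b := by linarith
    have f1 := mul_le_mul_of_nonneg_left e1 (mul_pos hb B0).le
    have f2 := mul_le_mul_of_nonneg_left e2 (mul_pos a0 (sub_pos.2 ha)).le
    have f3 := mul_le_mul_of_nonneg_right (hbq.trans_le (hqq.trans hqa.le)).le
      (mul_nonneg B0.le e3)
    linarith
  have k2 := mul_nonneg (sub_nonneg.2 hqq) (sub_nonneg.2 k1)
  rw [← sub_nonneg]
  refine k2.trans_eq ?_
  ring

/-- Multiplied by a - b, the expression is b(1 - b)(a - q) + a(1 - a)(q - b). -/
lemma pos_scale (hb : 0 < b) (hqa : q < a) (hab : b < a) (hbq : b < q) (ha : a < 1) :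
    0 < a * b - (a + b - 1) * q := by
  have h1 := mul_pos (mul_pos hb (by linarith : 0 < 1 - b)) (sub_pos.2 hqa)
  have h2 := mul_pos (mul_pos (hb.trans hab) (sub_pos.2 ha)) (sub_pos.2 hbq)
  have h3 : 0 < (a - b) * (a * b - (a + b - 1) * q) := by linarith
  exact (pos_iff_pos_of_mul_pos h3).1 (sub_pos.2 hab)

/-- No matrix beats the balanced diagonal one. -/
lemma le_balanced (hb : 0 < b) (hbq' : b < q') (hqa' : q' < a) (hbq : b < q) (hqa : q < a)
    (ha : a < 1) (hcrit : a * (1 - a) * (q' - b) ^ 2 = b * (1 - b) * (a - q') ^ 2)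
    (hz : q' * (z + 1) = 1)
    (hA' : Δ * (1 - b) = (1 - a) * (q' - b) * (1 * (1 - b) - z * b))
    (hB' : Δ * a = b * (a - q') * (z * a - 1 * (1 - a)))
    (hS : q * (x + y) ≤ 1) (hy : y ≤ 1)
    (hA : G * (1 - b) ≤ (1 - a) * (q - b) * (y * (1 - b) - x * b))
    (hB : G * a ≤ b * (a - q) * (x * a - y * (1 - a))) : G ≤ Δ := by
  have hba : b < a := by linarith
  have a0 : 0 < a := by linarith
  have A0 : 0 < 1 - a := by linarith
  rcases le_or_gt q q' with hle | hlt
  · have h1 := bound_of_le_one hbq hqa ha a0 hy hA hB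
    have h2 : Δ * (a * ((1 - b) * (a - q') + (1 - a) * (q' - b))) =
        (1 - a) * (a - b) * ((q' - b) * (a - q')) := by
      linear_combination (a * (a - q')) * hA' + (1 - a) * (q' - b) * hB'
    have h3 := le_one_bound_mono hb hbq hle hqa' ha hcrit
    have p1 : 0 < a * ((1 - b) * (a - q) + (1 - a) * (q - b)) :=
      mul_pos a0 (add_pos (mul_pos (by linarith) (by linarith)) (mul_pos A0 (by linarith)))
    have p2 : 0 < (1 - b) * (a - q') + (1 - a) * (q' - b) :=
      add_pos (mul_pos (by linarith) (by linarith)) (mul_pos A0 (by linarith))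
    have h4 := mul_le_mul_of_nonneg_left h3 (mul_pos A0 (sub_pos.2 hba)).le
    refine le_of_mul_le_mul_right ?_ (mul_pos p1 p2)
    have h5 := mul_le_mul_of_nonneg_right h1 p2.le
    have h6 : Δ * (a * ((1 - b) * (a - q) + (1 - a) * (q - b)) *
        ((1 - b) * (a - q') + (1 - a) * (q' - b))) = (1 - a) * (a - b) *
        ((q' - b) * (a - q') * ((1 - b) * (a - q) + (1 - a) * (q - b))) := by
      linear_combination ((1 - b) * (a - q) + (1 - a) * (q - b)) * h2
    linarith
  · have h1 := bound_of_scale hb hbq hqa ha hS hA hB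
    have h2 : Δ * (q' * (a * b - (a + b - 1) * q')) = (1 - a) * b * ((q' - b) * (a - q')) := by
      have : (a - b) * (Δ * (a * b - (a + b - 1) * q')) =
          (a - b) * ((1 - a) * b * ((q' - b) * (a - q')) * (z + 1)) := by
        linear_combination (b * (a - q')) * hA' + (1 - a) * (q' - b) * hB'
      have := mul_left_cancel₀ (sub_pos.2 hba).ne' this
      linear_combination q' * this + (1 - a) * b * ((q' - b) * (a - q')) * hz
    have h3 := scale_bound_anti hb hbq' hlt hqa ha hcrit.ge
    have p1 := mul_pos (hb.trans hbq) (pos_scale hb hqa hba hbq ha)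
    have p2 := mul_pos (hb.trans hbq') (pos_scale hb hqa' hba hbq' ha)
    have h4 := mul_le_mul_of_nonneg_left h3.le (mul_pos A0 hb).le
    refine le_of_mul_le_mul_right ?_ (mul_pos p1 p2)
    have h5 := mul_le_mul_of_nonneg_right h1 p2.le
    have h6 : Δ * (q * (a * b - (a + b - 1) * q) * (q' * (a * b - (a + b - 1) * q'))) =
        (1 - a) * b * ((q' - b) * (a - q') * (q * (a * b - (a + b - 1) * q))) := by
      linear_combination (q * (a * b - (a + b - 1) * q)) * h2
    linarith

/-- To the right of `q' = 1 - b` beyond the critical point, the gap stays below its limit. -/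
lemma lt_limit (hb : 0 < b) (hbq' : b < q') (hqq : q' < q) (hqa : q < a)
    (ha : a < 1) (hcrit : b * (1 - b) * (a - q') ^ 2 ≤ a * (1 - a) * (q' - b) ^ 2)
    (hΔ : Δ * (q' * (a * b - (a + b - 1) * q')) = (1 - a) * b * ((q' - b) * (a - q')))
    (hS : q * (x + y) ≤ 1)
    (hA : G * (1 - b) ≤ (1 - a) * (q - b) * (y * (1 - b) - x * b))
    (hB : G * a ≤ b * (a - q) * (x * a - y * (1 - a))) : G < Δ := by
  have hba : b < a := by linarith
  have hbq : b < q := by linarith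
  have A0 : 0 < 1 - a := by linarith
  have h1 := bound_of_scale hb hbq hqa ha hS hA hB
  have h3 := scale_bound_anti hb hbq' hqq hqa ha hcrit
  have p1 := mul_pos (hb.trans hbq) (pos_scale hb hqa hba hbq ha)
  have p2 := mul_pos (hb.trans hbq') (pos_scale hb (hqq.trans hqa) hba hbq' ha)
  have h4 := mul_lt_mul_of_pos_left h3 (mul_pos A0 hb)
  refine lt_of_mul_lt_mul_right ?_ (mul_pos p1 p2).le
  have h5 := mul_le_mul_of_nonneg_right h1 p2.le
  have h6 : Δ * (q * (a * b - (a + b - 1) * q) * (q' * (a * b - (a + b - 1) * q'))) =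
      (1 - a) * b * ((q' - b) * (a - q') * (q * (a * b - (a + b - 1) * q))) := by
    linear_combination (q * (a * b - (a + b - 1) * q)) * hΔ
  linarith

/-- If lying is an equilibrium, no matrix beats the one that balances lying and the equilibrium in
which agents with signal `0` are indifferent. -/
lemma le_of_lying (hb : 0 < b) (hbq : b < q) (ha : a < 1) (hw : 1 < a + b)
    (hqB : q ≤ 1 - b) (hη0 : b < η * (1 - b)) (hη1 : η < 1)
    (hη : (1 - a) * (η * (1 - b) - b) ^ 2 = (1 - b) * (a + b - 1) * (1 - η ^ 2))
    (hx : x ≤ 1) (hS : (1 - q) * (x + y) ≤ 1)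
    (hA : G * (1 - b) ≤ (1 - a) * (q - b) * (y * (1 - b) - x * b))
    (hL : G ≤ (a + b - 1) * (x - q * (x + y))) : G ≤ (a + b - 1) * (1 - η) := by
  have w0 : 0 < a + b - 1 := by linarith
  have A0 : 0 < 1 - a := by linarith
  have B0 : 0 < 1 - b := by linarith
  have e0 : 0 < η := by
    by_contra hc
    nlinarith [mul_nonneg (neg_nonneg.2 (not_lt.1 hc)) B0.le]
  have q0 : 0 < q - b := by linarith
  have hη2 : (1 - a) * (1 - b * (1 - b) * (1 + η) ^ 2) = b * (1 - b) * (1 - η ^ 2) := by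
    linear_combination hη
  have m0 : 0 < 1 - b * (1 - b) * (1 + η) ^ 2 := by
    have : 0 < (1 - a) * (1 - b * (1 - b) * (1 + η) ^ 2) := by
      rw [hη2]; exact mul_pos (mul_pos hb B0) (by nlinarith)
    exact (pos_iff_pos_of_mul_pos this).1 A0
  have AL := mul_le_mul_of_nonneg_left hL (mul_pos A0 q0).le
  -- The split is at q = η/(1 + η), the threshold of diag(1, η), where x ≤ 1 and (1 - q)(x + y) ≤ 1
  -- are both equalities. By `hη` the deficits of lying and of the mixed equilibrium agree there.
  rcases le_total (q * (1 + η)) η with hle | hle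
  · -- the scale is bounded by the reward for the report `1`
    have h1 : G * ((1 - q) * ((1 - b) * (a + b - 1) + (1 - a) * (q - b))) ≤
        (1 - a) * (a + b - 1) * ((q - b) * (1 - b - q)) := by
      have h2 := mul_le_mul_of_nonneg_left hA w0.le
      have h3 : G * ((1 - b) * (a + b - 1) + (1 - a) * (q - b)) ≤
          (1 - a) * (a + b - 1) * ((q - b) * (1 - b - q)) * (x + y) := by linarith
      have h4 := mul_le_mul_of_nonneg_left h3 (by linarith : 0 ≤ 1 - q)
      have h5 := mul_le_mul_of_nonneg_left hS
        (mul_nonneg (mul_pos A0 w0).le (mul_nonneg q0.le (sub_nonneg.2 hqB)))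
      linarith
    have h6 : 0 ≤ (1 - η) * ((1 - q) * ((1 - b) * (a + b - 1) + (1 - a) * (q - b))) -
        (1 - a) * ((q - b) * (1 - b - q)) := by
      -- Expand around q = η/(1 + η) after clearing denominators: the constant term vanishes by
      -- `hη`, and the linear and quadratic parts are nonnegative.
      refine le_of_mul_le_mul_left ?_ (by positivity : (0 : ℝ) < (1 + η) ^ 2)
      have k1 : 0 ≤ (η - q * (1 + η)) * ((1 - η) * ((1 + η) * ((1 - b) * (a + b - 1)) +
          (1 - a) * (η * (1 - b) - b))) :=
        mul_nonneg (by linarith) (mul_nonneg (by linarith) (add_nonneg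
          (mul_pos (by linarith) (mul_pos B0 w0)).le (mul_pos A0 (by linarith)).le))
      have k2 : 0 ≤ (1 - a) * η * (η - q * (1 + η)) ^ 2 := by positivity
      have k3 := add_nonneg k1 k2
      rw [mul_zero]
      refine k3.trans_eq ?_
      linear_combination hη
    have p : 0 < (1 - q) * ((1 - b) * (a + b - 1) + (1 - a) * (q - b)) :=
      mul_pos (by linarith) (add_pos (mul_pos B0 w0) (mul_pos A0 q0))
    refine le_of_mul_le_mul_right ?_ p
    have h7 := mul_le_mul_of_nonneg_left (sub_nonneg.1 h6) w0.le
    linarith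
  · -- the scale is bounded by the gain from reporting `1` to a peer who does so
    have h1 : G * (b * (1 - b) * (q - (1 - a))) ≤
        (1 - a) * (a + b - 1) * ((q - b) * (1 - b - q)) := by
      have h2 := mul_le_mul_of_nonneg_left hA (mul_pos (hb.trans hbq) w0).le
      have h3 := mul_le_mul_of_nonneg_left AL B0.le
      have h5 := mul_le_mul_of_nonneg_left hx
        (mul_nonneg (mul_pos A0 w0).le (mul_nonneg q0.le (sub_nonneg.2 hqB)))
      linarith
    have h6 : 0 ≤ (1 - η) * (b * (1 - b) * (q - (1 - a))) -
        (1 - a) * ((q - b) * (1 - b - q)) := by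
      refine le_of_mul_le_mul_left ?_ (by positivity : (0 : ℝ) < (1 + η) ^ 2)
      have k0 : 0 ≤ b * (1 - b) * (1 + η) - (1 - a) := by
        refine le_of_mul_le_mul_left ?_ m0
        have : 0 ≤ b * (1 - b) * (1 + η) * ((η * (1 - b) - b) * (1 - b - b * η)) :=
          mul_nonneg (mul_pos (mul_pos hb B0) (by linarith)).le
            (mul_nonneg (by linarith) (by nlinarith))
        rw [mul_zero]
        refine this.trans_eq ?_
        linear_combination hη2
      have k1 : 0 ≤ (q * (1 + η) - η) * ((1 - η) * (b * (1 - b) * (1 + η) - (1 - a))) :=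
        mul_nonneg (by linarith) (mul_nonneg (by linarith) k0)
      have k2 : 0 ≤ (1 - a) * (q * (1 + η) - η) ^ 2 := by positivity
      have k3 := add_nonneg k1 k2
      rw [mul_zero]
      refine k3.trans_eq ?_
      linear_combination η * hη2
    have p : 0 < b * (1 - b) * (q - (1 - a)) := mul_pos (mul_pos hb B0) (by linarith)
    refine le_of_mul_le_mul_right ?_ p
    have h7 := mul_le_mul_of_nonneg_left (sub_nonneg.1 h6) w0.le
    linarith

end

noncomputable section

/-! ### The tuned mechanisms -/

variable {a b : ℝ}

/-- The square root in q_{a,o} is ζ a b, so q_{a,o} = 1/(1 + ζ) is the indifference threshold of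
diag(ζ, 1). -/
lemma zeta_spec (hb : 0 < b) (hab : b < a) (ha : a < 1) (hw : 1 < a + b) :
    0 < zeta (cc a b) ∧ zeta (cc a b) < 1 ∧ b * zeta (cc a b) < 1 - b ∧
      1 - a < a * zeta (cc a b) ∧ zeta (cc a b) ^ 2 * (a * b) = (1 - a) * (1 - b) ∧
      rad (cc a b) = zeta (cc a b) * (a * b) ∧ qao (cc a b) * (zeta (cc a b) + 1) = 1 := by
  have A0 : 0 < 1 - a := by linarith
  have B0 : 0 < 1 - b := by linarith
  have a0 : 0 < a := by linarith
  have hz : zeta (cc a b) = √(((1 - b) * (1 - a)) / (b * a)) := rfl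
  have hr : rad (cc a b) = √((1 - b) * b * (1 - a) * a) := rfl
  have hq : qao (cc a b) = (b * a - rad (cc a b)) / (a - (1 - b)) := rfl
  set z := zeta (cc a b)
  have z0 : 0 < z := by rw [hz]; positivity
  have hsq : z ^ 2 * (a * b) = (1 - a) * (1 - b) := by
    rw [hz, Real.sq_sqrt (by positivity)]; field_simp
  have hrad : rad (cc a b) = z * (a * b) := by
    rw [hr, Real.sqrt_eq_iff_mul_self_eq (by positivity) (by positivity)]
    linear_combination (-(a * b)) * hsq
  have z1 : z < 1 := by
    by_contra hc
    have h1 : 1 ≤ z ^ 2 := by nlinarith [not_lt.1 hc]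
    nlinarith [mul_le_mul_of_nonneg_right h1 (mul_pos a0 hb).le]
  have hbz : b * z < 1 - b := by
    refine lt_of_pow_lt_pow_left₀ 2 B0.le ?_
    refine lt_of_mul_lt_mul_left ?_ a0.le
    have : a * (b * z) ^ 2 = b * ((1 - a) * (1 - b)) := by rw [← hsq]; ring
    rw [this]
    nlinarith [mul_pos B0 (sub_pos.2 hab)]
  have haz : 1 - a < a * z := by
    refine lt_of_pow_lt_pow_left₀ 2 (by positivity) ?_
    refine lt_of_mul_lt_mul_left ?_ hb.le
    have : b * (a * z) ^ 2 = a * ((1 - a) * (1 - b)) := by rw [← hsq]; ring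
    rw [this]
    nlinarith [mul_pos A0 (sub_pos.2 hab)]
  refine ⟨z0, z1, hbz, haz, hsq, hrad, ?_⟩
  have w0 : a - (1 - b) ≠ 0 := by intro h; linarith
  rw [hq, hrad, div_mul_eq_mul_div, div_eq_iff w0]
  linear_combination -hsq

lemma qao_spec (hb : 0 < b) (hab : b < a) (ha : a < 1) (hw : 1 < a + b) :
    b < qao (cc a b) ∧ qao (cc a b) < a ∧
      a * (1 - a) * (qao (cc a b) - b) ^ 2 = b * (1 - b) * (a - qao (cc a b)) ^ 2 := by
  obtain ⟨z0, z1, hbz, haz, hsq, -, hq⟩ := zeta_spec hb hab ha hw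
  set z := zeta (cc a b)
  set p := qao (cc a b)
  have hp : p = 1 / (z + 1) := by field_simp; linarith
  refine ⟨?_, ?_, ?_⟩
  · rw [hp, lt_div_iff₀ (by linarith)]; linarith
  · rw [hp, div_lt_iff₀ (by linarith)]; linarith
  · have e1 : p - b = p * (1 - b - b * z) := by linear_combination b * hq
    have e2 : a - p = p * (a * z - (1 - a)) := by linear_combination a * -hq
    have e3 : (1 - b) * (a * z - (1 - a)) = a * z * (1 - b - b * z) := by
      linear_combination hsq
    have B0 : 1 - b ≠ 0 := by intro h; linarith
    rw [e1, e2]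
    refine mul_left_cancel₀ B0 ?_
    linear_combination (-(b * p ^ 2) * ((1 - b) * (a * z - (1 - a)) + a * z * (1 - b - b * z))) * e3
      - (a * p ^ 2 * (1 - b - b * z) ^ 2) * hsq

/-- The choice of ζ equalises the deficits of the two permanent mixed equilibria in diag(ζ, 1); Δ_a
is their common value. -/
lemma deltaA_spec (hb : 0 < b) (hab : b < a) (ha : a < 1) (hw : 1 < a + b) :
    0 < deltaA (cc a b) ∧
    (b + (1 - a)) * deltaA (cc a b) * (1 - b) =
      (1 - a) * (qao (cc a b) - b) * (1 * (1 - b) - zeta (cc a b) * b) ∧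
    (b + (1 - a)) * deltaA (cc a b) * a =
      b * (a - qao (cc a b)) * (zeta (cc a b) * a - 1 * (1 - a)) := by
  obtain ⟨z0, z1, hbz, haz, hsq, hr, hq⟩ := zeta_spec hb hab ha hw
  have hD : deltaA (cc a b) = ((1 - a) * ((1 - b) * b - rad (cc a b)) *
      (rad (cc a b) - (1 - a) * a)) / (((1 - a) + b) * a * (a - (1 - b)) *
        (rad (cc a b) + a - (1 - b) - b * a)) := rfl
  rw [hr] at hD
  set z := zeta (cc a b)
  set p := qao (cc a b)
  have A0 : 0 < 1 - a := by linarith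
  have B0 : 0 < 1 - b := by linarith
  have a0 : 0 < a := by linarith
  have e1 : p - b = p * (1 - b - b * z) := by linear_combination b * hq
  have e2 : a - p = p * (a * z - (1 - a)) := by linear_combination a * -hq
  have e3 : (1 - b) * (a * z - (1 - a)) = a * z * (1 - b - b * z) := by
    linear_combination hsq
  have hp : p = 1 / (z + 1) := by field_simp; linarith
  have p0 : 0 < p := by rw [hp]; positivity
  -- the factors of the formula
  have f1 : (1 - b) * b - z * (a * b) = b * (a * (1 - z) * (1 - b - b * z)) := by
    linear_combination -b * hsq
  have f2 : z * (a * b) - (1 - a) * a = a * (b * (1 - z) * (a * z - (1 - a))) := by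
    linear_combination a * hsq
  have f3 : z * (a * b) + a - (1 - b) - b * a = z * (a * b) * (1 - z) := by
    linear_combination hsq
  have f4 : a - (1 - b) = a * b * ((1 - z) * (z + 1)) := by linear_combination hsq
  have z1' : 0 < 1 - z := by linarith
  have key : (b + (1 - a)) * deltaA (cc a b) * (1 - b) =
      (1 - a) * (1 - b - b * z) ^ 2 * p := by
    have hd : 0 < b + (1 - a) := by linarith
    have hd' : (1 - a) + b = b + (1 - a) := by ring
    have e4 : (b + (1 - a)) * deltaA (cc a b) * (1 - b) = (1 - a) * (1 - b - b * z) *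
        ((1 - b) * (a * z - (1 - a))) / (a * z * (z + 1)) := by
      rw [hD, f1, f2, f3, f4, hd']
      clear_value z
      generalize 1 - b - b * z = X
      generalize a * z - (1 - a) = Y
      generalize b + (1 - a) = D at *
      generalize 1 - z = Z at *
      field_simp
    rw [e4, e3, hp]
    field_simp
  have key2 : (b + (1 - a)) * deltaA (cc a b) * a = b * (a * z - (1 - a)) ^ 2 * p := by
    refine mul_left_cancel₀ B0.ne' ?_
    refine mul_left_cancel₀ B0.ne' ?_
    linear_combination ((1 - b) * a) * key -
      (b * p * ((1 - b) * (a * z - (1 - a)) + a * z * (1 - b - b * z))) * e3 -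
      (a * p * (1 - b - b * z) ^ 2) * hsq
  refine ⟨?_, ?_, ?_⟩
  · have h1 : 0 < (1 - a) * (1 - b - b * z) ^ 2 * p := by
      have : 0 < 1 - b - b * z := by linarith
      positivity
    rw [← key] at h1
    have h2 := (pos_iff_pos_of_mul_pos h1).2 B0
    exact (pos_iff_pos_of_mul_pos h2).1 (by linarith)
  · rw [key, e1]; ring
  · rw [key2, e2]; ring

/-- Only equilibria that exist for every admissible matrix are used, so this holds on either side of
q_{a,o} = 1 - b. -/
lemma symGap_le_deltaA {h : Bool → Bool → ℝ} (hb : 0 < b) (hab : b < a) (ha : a < 1)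
    (hw : 1 < a + b) (hh : Admissible a b h) : symGap a b h ≤ deltaA (cc a b) := by
  obtain ⟨x, y, q, hK, hbq, hqa, -, hy, hS, -, hA, hB, -⟩ := hh.gap_bounds hb hab ha hw
  obtain ⟨h1, h2, h3⟩ := qao_spec hb hab ha hw
  obtain ⟨-, h4, h5⟩ := deltaA_spec hb hab ha hw
  obtain ⟨-, -, -, -, -, -, h6⟩ := zeta_spec hb hab ha hw
  refine le_of_mul_le_mul_left ?_ (by linarith : 0 < b + (1 - a))
  exact le_balanced hb h1 h2 hbq hqa ha h3 h6 h4 h5 hS hy hA hB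

lemma admissible_mat_diag {u v : ℝ} (hu : 0 ≤ u ∧ u ≤ 1) (hv : 0 ≤ v ∧ v ≤ 1)
    (huv : u = 1 ∨ v = 1) (h1 : (1 - a) * v < a * u) (h2 : b * u < (1 - b) * v) :
    Admissible a b (mat u 0 0 v) := by
  refine ⟨?_, ⟨true, false, rfl⟩, ?_, ?_, ?_⟩
  · intro i j
    cases i <;> cases j <;> simp only [mat]
    · exact hv
    · norm_num
    · norm_num
    · exact hu
  · rcases huv with h | h
    · exact ⟨true, true, h⟩
    · exact ⟨false, false, h⟩
  · simp only [payFor, mat]; linarith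
  · simp only [payFor, mat]; linarith

lemma balanced_spec (hb : 0 < b) (hab : b < a) (ha : a < 1) (hw : 1 < a + b)
    (hq : 1 - b < qao (cc a b)) : Admissible a b (mat (zeta (cc a b)) 0 0 1) ∧
      symGap a b (mat (zeta (cc a b)) 0 0 1) = deltaA (cc a b) := by
  obtain ⟨z0, z1, hbz, haz, -, -, hq1⟩ := zeta_spec hb hab ha hw
  obtain ⟨h1, h2, -⟩ := qao_spec hb hab ha hw
  obtain ⟨-, h4, h5⟩ := deltaA_spec hb hab ha hw
  have F : HasForm (mat (zeta (cc a b)) 0 0 1) (zeta (cc a b)) 1 (qao (cc a b)) :=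
    ⟨by simp [mat], by simp [mat], by simp only [mat]; linarith⟩
  refine ⟨admissible_mat_diag ⟨z0.le, z1.le⟩ ⟨by norm_num, le_rfl⟩ (Or.inr rfl)
    (by linarith) (by linarith), ?_⟩
  -- With a threshold above 1 - b, neither lying nor the equilibrium with report 0 on signal 1 and
  -- indifference on signal 0 exists.
  exact F.symGap_eq (by linarith) hb h1 h2 ha hw z0.le h4 h5.le
    (fun h => absurd h hq.not_ge) (fun h => absurd h hq.not_ge)

/-- η solves the quadratic equation that equates, in diag(1, η), the deficit of lying with that of
the equilibrium in which signal 0 is indifferent. Δ_b is the common value. -/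
lemma eta_spec (hb : 0 < b) (hab : b < a) (ha : a < 1) (hw : 1 < a + b) (hB : b < 1 - b) :
    b < eta (cc a b) * (1 - b) ∧ eta (cc a b) < 1 ∧
      (1 - a) * (eta (cc a b) * (1 - b) - b) ^ 2 =
        (1 - b) * (a + b - 1) * (1 - eta (cc a b) ^ 2) ∧
      (b + (1 - a)) * deltaB (cc a b) = (a + b - 1) * (1 - eta (cc a b)) := by
  have A0 : 0 < 1 - a := by linarith
  have B0 : 0 < 1 - b := by linarith
  have a0 : 0 < a := by linarith
  have w0 : 0 < a - (1 - b) := by linarith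
  have d0 : 0 < a - b := by linarith
  have hη : eta (cc a b) =
      1 / a * (√(((a - b) * (a - (1 - b))) / ((1 - b) * b)) + (1 - a)) := rfl
  have hΔ : deltaB (cc a b) = ((a - (1 - b)) * ((1 - b) * b * (a - (1 - a)) -
      √((1 - b) * b * (a - b) * (a - (1 - b))))) / ((b + (1 - a)) * b * a * (1 - b)) := rfl
  set r := √(((a - b) * (a - (1 - b))) / ((1 - b) * b)) with hr
  set η := eta (cc a b)
  have r0 : 0 < r := by rw [hr]; positivity
  have rsq : r ^ 2 * ((1 - b) * b) = (a - b) * (a - (1 - b)) := by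
    rw [hr, Real.sq_sqrt (by positivity)]; field_simp
  have hs : √((1 - b) * b * (a - b) * (a - (1 - b))) = (1 - b) * b * r := by
    rw [Real.sqrt_eq_iff_mul_self_eq (by positivity) (by positivity)]
    linear_combination (-((1 - b) * b)) * rsq
  have hηr : a * η = r + (1 - a) := by rw [hη]; field_simp
  have bb : 0 < (1 - b) * b := mul_pos B0 hb
  have hη1 : η < 1 := by
    have : r < 2 * a - 1 := by
      refine lt_of_pow_lt_pow_left₀ 2 (by linarith) ?_
      refine lt_of_mul_lt_mul_right ?_ bb.le
      rw [rsq]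
      have : 0 < a * (1 - a) * (1 - b - b) ^ 2 := by
        have : 0 < 1 - b - b := by linarith
        positivity
      linarith
    refine lt_of_mul_lt_mul_left ?_ a0.le
    linarith
  have hη0 : b < η * (1 - b) := by
    have : a - (1 - b) < r * (1 - b) := by
      refine lt_of_pow_lt_pow_left₀ 2 (by positivity) ?_
      refine lt_of_mul_lt_mul_right ?_ hb.le
      have e : (r * (1 - b)) ^ 2 * b = (1 - b) * ((a - b) * (a - (1 - b))) := by
        rw [← rsq]; ring
      rw [e]
      have : 0 < (a - (1 - b)) * (a * (1 - b - b)) :=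
        mul_pos w0 (mul_pos a0 (by linarith))
      linarith
    refine lt_of_mul_lt_mul_left ?_ a0.le
    have : a * (η * (1 - b)) = (r + (1 - a)) * (1 - b) := by rw [← hηr]; ring
    rw [this]
    linarith
  refine ⟨hη0, hη1, ?_, ?_⟩
  · refine mul_left_cancel₀ a0.ne' ?_
    have hr' : r = a * η - (1 - a) := by linarith
    rw [hr'] at rsq
    linear_combination rsq
  · have hr' : r = a * η - (1 - a) := by linarith
    rw [hΔ, hs, hr']
    have : b + (1 - a) ≠ 0 := by intro h; linarith
    field_simp
    ring

lemma lying_spec (hb : 0 < b) (hab : b < a) (ha : a < 1) (hw : 1 < a + b) (hB : b < 1 - b) :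
    0 < deltaB (cc a b) ∧ Admissible a b (mat 1 0 0 (eta (cc a b))) ∧
      symGap a b (mat 1 0 0 (eta (cc a b))) = deltaB (cc a b) := by
  obtain ⟨hη0, hη1, hη, hΔ⟩ := eta_spec hb hab ha hw hB
  set η := eta (cc a b)
  have A0 : 0 < 1 - a := by linarith
  have B0 : 0 < 1 - b := by linarith
  have a0 : 0 < a := by linarith
  have w0 : 0 < a + b - 1 := by linarith
  have η0 : 0 < η := by
    by_contra hc
    nlinarith [mul_nonneg (neg_nonneg.2 (not_lt.1 hc)) B0.le]
  have hq : η / (1 + η) * (1 + η) = η := by field_simp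
  have F : HasForm (mat 1 0 0 η) 1 η (η / (1 + η)) :=
    ⟨by simp [mat], by simp [mat], by simp only [mat]; linarith⟩
  have hqb : b < η / (1 + η) := by rw [lt_div_iff₀ (by linarith)]; linarith
  have hqa : η / (1 + η) < a := by
    rw [div_lt_iff₀ (by linarith)]
    nlinarith
  refine ⟨?_, admissible_mat_diag ⟨by norm_num, le_rfl⟩ ⟨η0.le, hη1.le⟩ (Or.inl rfl)
    (by nlinarith) (by linarith), ?_⟩
  · have : 0 < (b + (1 - a)) * deltaB (cc a b) := by
      rw [hΔ]; exact mul_pos w0 (by linarith)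
    exact (pos_iff_pos_of_mul_pos this).1 (by linarith)
  refine F.symGap_eq (by linarith) hb hqb hqa ha hw (by norm_num) ?_ ?_ ?_ ?_
  · rw [hΔ]
    field_simp
    linear_combination -hη
  · rw [hΔ]
    -- As η < 1, this reduces to a(1 - a)(1 - 2b)² ≤ b(1 - b)(2a - 1)², whose sides differ by (a -
    -- b)(a + b - 1).
    have h1 : (1 - a) * a * (η * (1 - b) - b) ^ 2 ≤ b * (1 - b) * (a - η * (1 - a)) ^ 2 := by
      have e1 : (η * (1 - b) - b) ^ 2 ≤ (1 - b - b) ^ 2 := by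
        refine pow_le_pow_left₀ (by linarith) ?_ 2
        nlinarith
      have e2 : (a - (1 - a)) ^ 2 ≤ (a - η * (1 - a)) ^ 2 := by
        refine pow_le_pow_left₀ (by linarith) ?_ 2
        nlinarith
      have e3 := mul_le_mul_of_nonneg_left e1 (mul_pos A0 a0).le
      have e4 := mul_le_mul_of_nonneg_left e2 (mul_pos hb B0).le
      have e5 : 0 ≤ (a - b) * (a + b - 1) := mul_nonneg (by linarith) w0.le
      linarith
    refine le_of_mul_le_mul_left ?_ B0
    have e : b * (a - η / (1 + η)) * (1 * a - η * (1 - a)) =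
        b * (a - η * (1 - a)) ^ 2 / (1 + η) := by field_simp; ring
    rw [e, mul_div_assoc', le_div_iff₀ (by linarith)]
    have e' : (1 - b) * ((a + b - 1) * (1 - η) * a) * (1 + η) =
        (1 - a) * a * (η * (1 - b) - b) ^ 2 := by linear_combination -a * hη
    rw [e']
    linarith
  · intro _
    rw [hΔ]
    have e : 1 * (b * (a - η / (1 + η)) * (1 - b)) +
        η * ((1 - a) * (η / (1 + η) - b) * (1 - b) - b * (η / (1 + η)) * (a - b)) -
        (a + b - 1) * (1 - η) * (1 - b) = (1 - a) * (1 - b - b * η) ^ 2 / (1 + η) := by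
      field_simp
      ring
    have : 0 ≤ (1 - a) * (1 - b - b * η) ^ 2 / (1 + η) := by positivity
    linarith
  · intro _
    rw [hΔ, hq]

lemma symGap_le_deltaB {h : Bool → Bool → ℝ} (hb : 0 < b) (hab : b < a) (ha : a < 1)
    (hw : 1 < a + b) (hB : b < 1 - b) (hh : Admissible a b h) {ι : ℝ}
    (hcrit : qao (cc a b) ≤ 1 - b)
    (hι : (b + (1 - a)) * ι * ((1 - b) * (a * b - (a + b - 1) * (1 - b))) =
      (1 - a) * b * ((1 - b - b) * (a - (1 - b)))) :
    symGap a b h ≤ deltaB (cc a b) ∨ symGap a b h < ι := by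
  obtain ⟨x, y, q, hK, hbq, hqa, hx, hy, hS, hS', hA, hB', hL⟩ := hh.gap_bounds hb hab ha hw
  obtain ⟨hη0, hη1, hη, hΔ⟩ := eta_spec hb hab ha hw hB
  obtain ⟨h1, h2, h3⟩ := qao_spec hb hab ha hw
  have hD : 0 < b + (1 - a) := by linarith
  rcases le_or_gt q (1 - b) with hq | hq
  · left
    refine le_of_mul_le_mul_left ?_ hD
    rw [hΔ]
    exact le_of_lying hb hbq ha hw hq hη0 hη1 hη hx hS' hA (hL hq)
  · right
    refine lt_of_mul_lt_mul_left ?_ hD.le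
    refine lt_limit hb hB hq hqa ha ?_ hι hS hA hB'
    -- The critical inequality is an equality at q_{a,o} and passes to the larger point 1 - b.
    have B0 : 0 < 1 - b := by linarith
    have e1 : (a - (1 - b)) ^ 2 ≤ (a - qao (cc a b)) ^ 2 :=
      pow_le_pow_left₀ (by linarith) (by linarith) 2
    have e2 : (qao (cc a b) - b) ^ 2 ≤ (1 - b - b) ^ 2 :=
      pow_le_pow_left₀ (by linarith) (by linarith) 2
    have e3 := mul_le_mul_of_nonneg_left e1 (mul_pos hb B0).le
    have e4 := mul_le_mul_of_nonneg_left e2 (mul_pos (hb.trans hab) (sub_pos.2 ha)).le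
    linarith

/-- Up to the factor b + 1 - a, ι and κ are the bounds of `bound_of_scale` and `bound_of_le_one` at
q = 1 - b. This point lies beyond their crossing q_{a,o}, where the former is the smaller. -/
lemma iota_spec (hb : 0 < b) (hab : b < a) (ha : a < 1) (hw : 1 < a + b) (hB : b < 1 - b)
    (hcrit : qao (cc a b) ≤ 1 - b) :
    (b + (1 - a)) * iotaA (cc a b) * ((1 - b) * (a * b - (a + b - 1) * (1 - b))) =
      (1 - a) * b * ((1 - b - b) * (a - (1 - b))) ∧
    min (iotaA (cc a b)) (kappaA (cc a b)) = iotaA (cc a b) := by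
  have A0 : 0 < 1 - a := by linarith
  have B0 : 0 < 1 - b := by linarith
  have a0 : 0 < a := by linarith
  have hD : 0 < b + (1 - a) := by linarith
  have hι : iotaA (cc a b) = (1 - a) / (b + (1 - a)) * ((b * (a - (1 - b)) * (1 - b - b)) /
    ((1 - b) * (b * a - (a - (1 - b)) * (1 - b)))) := rfl
  have hκ : kappaA (cc a b) = (1 - a) / (b + (1 - a)) * (((a - (1 - b)) * (1 - b - b)) /
    (a * (1 - (1 - b)))) := rfl
  have N0 : 0 < b * a - (a - (1 - b)) * (1 - b) := by
    have := pos_scale hb (q := 1 - b) (by linarith) hab hB ha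
    linarith
  constructor
  · have e : a * b - (a + b - 1) * (1 - b) = b * a - (a - (1 - b)) * (1 - b) := by ring
    rw [hι, e]
    generalize b * a - (a - (1 - b)) * (1 - b) = N at *
    field_simp
  · obtain ⟨z0, z1, -, -, hsq, -, hq⟩ := zeta_spec hb hab ha hw
    refine min_eq_left ?_
    rw [hι, hκ]
    refine mul_le_mul_of_nonneg_left ?_ (div_pos A0 hD).le
    have k0 : 0 ≤ (a - (1 - b)) * (1 - b - b) := mul_nonneg (by linarith) (by linarith)
    have hbz : b ≤ zeta (cc a b) * (1 - b) := by
      have := mul_le_mul_of_nonneg_right hcrit (by linarith : 0 ≤ zeta (cc a b) + 1)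
      linarith
    have k1 : a * b ^ 3 ≤ (1 - a) * (1 - b) ^ 3 := by
      have e1 := pow_le_pow_left₀ hb.le hbz 2
      have e2 := mul_le_mul_of_nonneg_left e1 (mul_pos a0 hb).le
      have e3 : a * b * (zeta (cc a b) * (1 - b)) ^ 2 = (1 - a) * (1 - b) ^ 3 := by
        linear_combination (1 - b) ^ 2 * hsq
      linarith
    rw [div_le_div_iff₀ (mul_pos B0 N0) (by rw [sub_sub_cancel]; positivity)]
    have k2 : b * (a * (1 - (1 - b))) ≤ (1 - b) * (b * a - (a - (1 - b)) * (1 - b)) := by linarith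
    have := mul_le_mul_of_nonneg_left k2 k0
    linarith

end

/-! ### The mechanisms `tunedEps` and their limit -/

noncomputable section

variable {a b : ℝ}

lemma zetaEps_cc (a b ε : ℝ) : zetaEps (cc a b) ε = (1 - a) * (1 - b) /
    (a * b - (a + b - 1) * (1 - b + ε)) := by
  have e : zetaEps (cc a b) ε = ((1 - b) * (1 - a)) / ((1 - b) * (1 - a) * (1 - b + ε) +
      b * (a - a * (1 - b + ε))) := rfl
  rw [e]
  congr 1 <;> ring

lemma deltaEps_cc {ε : ℝ} (hX : 1 - b + ε ≠ 0)
    (hN : a * b - (a + b - 1) * (1 - b + ε) ≠ 0) : 1 - deltaEps (cc a b) ε =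
      a * b * (1 - (1 - b + ε)) / ((1 - b + ε) * (a * b - (a + b - 1) * (1 - b + ε))) := by
  have e : deltaEps (cc a b) ε = (b * a * (1 - b + ε - 1) ^ 2 -
      (1 - b) * (1 - a) * (1 - b + ε) ^ 2) / ((1 - b + ε) * (b * a * (1 - b + ε - 1) -
        (1 - b) * (1 - a) * (1 - b + ε))) := rfl
  have e' : b * a * (1 - b + ε - 1) - (1 - b) * (1 - a) * (1 - b + ε) =
      -(a * b - (a + b - 1) * (1 - b + ε)) := by ring
  rw [e, e', mul_neg, div_neg, sub_neg_eq_add, eq_div_iff (mul_ne_zero hX hN), add_mul,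
    div_mul_cancel₀ _ (mul_ne_zero hX hN)]
  ring

/-- With threshold X = 1 - b + ε just above 1 - b, lying is no equilibrium. The entries satisfy X(x
+ y) = 1 and equalise the two mixed deficits, so the bound of `bound_of_scale` is attained at X. -/
lemma tunedEps_spec (hb : 0 < b) (hab : b < a) (ha : a < 1) (hw : 1 < a + b) (hB : b < 1 - b)
    (hcrit : qao (cc a b) ≤ 1 - b) {ε : ℝ} (hε : 0 < ε) (hεa : 1 - b + ε < a) :
    Admissible a b (tunedEps (cc a b) ε) ∧
      symGap a b (tunedEps (cc a b) ε) =
        (1 - a) * b * ((1 - b + ε - b) * (a - (1 - b + ε))) /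
          ((b + (1 - a)) * ((1 - b + ε) * (a * b - (a + b - 1) * (1 - b + ε)))) := by
  have hbX : b < 1 - b + ε := by linarith
  have N0 := pos_scale hb hεa hab hbX ha
  have X0 : 0 < 1 - b + ε := by linarith
  have hζ := zetaEps_cc a b ε
  have hδ := deltaEps_cc (a := a) X0.ne' N0.ne'
  obtain ⟨z0, z1, -, -, hsq, -, hq⟩ := zeta_spec hb hab ha hw
  have hzX : 1 ≤ (zeta (cc a b) + 1) * (1 - b + ε) := by
    have := mul_le_mul_of_nonneg_left (hcrit.trans (by linarith : 1 - b ≤ 1 - b + ε))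
      (by linarith : 0 ≤ zeta (cc a b) + 1)
    linarith
  have hBX : 1 - b < 1 - b + ε := by linarith
  unfold tunedEps
  set X := 1 - b + ε
  set N := a * b - (a + b - 1) * X with hN
  set ζ := zetaEps (cc a b) ε
  set δ := deltaEps (cc a b) ε
  have A0 : 0 < 1 - a := by linarith
  have B0 : 0 < 1 - b := by linarith
  have a0 : 0 < a := by linarith
  have hD : 0 < b + (1 - a) := by linarith
  have hζ0 : 0 ≤ ζ := by rw [hζ]; positivity
  have hζ1 : ζ ≤ 1 := by
    rw [hζ, div_le_one N0, hN]
    nlinarith [mul_pos (sub_pos.2 hw) (by linarith : 0 < 1 - X)]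
  have hδ1 : 0 ≤ 1 - δ := by
    rw [hδ]
    exact div_nonneg (mul_nonneg (by positivity) (by linarith)) (by positivity)
  -- The entry δ is nonnegative because X is at least q_{a,o}.
  have hδ0 : 1 - δ ≤ 1 := by
    rw [hδ, div_le_one (by positivity)]
    have h1 : (1 - X) ^ 2 ≤ (zeta (cc a b) * X) ^ 2 :=
      pow_le_pow_left₀ (by linarith) (by linarith) 2
    have h2 := mul_le_mul_of_nonneg_left h1 (mul_pos a0 hb).le
    have h3 : a * b * (zeta (cc a b) * X) ^ 2 = (1 - a) * (1 - b) * X ^ 2 := by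
      linear_combination X ^ 2 * hsq
    rw [hN]
    linarith
  have hK : X * (ζ + (1 - δ)) = 1 := by
    rw [hδ, hζ]
    field_simp
    rw [hN]; ring
  have hK0 : 0 < ζ + (1 - δ) := by
    have : 0 < X * (ζ + (1 - δ)) := by rw [hK]; norm_num
    exact (pos_iff_pos_of_mul_pos this).1 X0
  have F : HasForm (mat ζ δ 0 1) ζ (1 - δ) X :=
    ⟨by simp [mat], by simp [mat], by simp only [mat]; linarith⟩
  refine ⟨⟨?_, ⟨false, true, rfl⟩, ⟨false, false, rfl⟩, ?_, ?_⟩, ?_⟩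
  · intro i j
    cases i <;> cases j <;> simp only [mat]
    · norm_num
    · norm_num
    · constructor <;> linarith
    · exact ⟨hζ0, hζ1⟩
  · rw [F.payFor_false, F.payFor_true]
    nlinarith [mul_pos hK0 (sub_pos.2 hεa)]
  · rw [F.payFor_false, F.payFor_true]
    nlinarith [mul_pos hK0 (sub_pos.2 hbX)]
  · refine F.symGap_eq hK0 hb hbX hεa ha hw hζ0 ?_ (le_of_eq ?_)
      (fun h => absurd h hBX.not_ge) (fun h => absurd h hBX.not_ge)
    · rw [hδ, hζ]
      field_simp
      ring
    · rw [hδ, hζ]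
      field_simp
      ring

lemma tendsto_symGap_tunedEps (hb : 0 < b) (hab : b < a) (ha : a < 1) (hw : 1 < a + b)
    (hB : b < 1 - b) (hcrit : qao (cc a b) ≤ 1 - b) :
    (∀ᶠ ε in 𝓝[>] (0 : ℝ), Admissible a b (tunedEps (cc a b) ε)) ∧
      Tendsto (fun ε => symGap a b (tunedEps (cc a b) ε)) (𝓝[>] 0) (𝓝 (iotaA (cc a b))) := by
  have hev : ∀ᶠ ε in 𝓝[>] (0 : ℝ), 0 < ε ∧ 1 - b + ε < a := by
    filter_upwards [Ioo_mem_nhdsGT (show (0 : ℝ) < a - (1 - b) by linarith)] with ε hε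
    exact ⟨hε.1, by linarith [hε.2]⟩
  refine ⟨hev.mono fun ε hε => (tunedEps_spec hb hab ha hw hB hcrit hε.1 hε.2).1, ?_⟩
  have N0 := pos_scale hb (q := 1 - b) (by linarith) hab hB ha
  have hD : 0 < b + (1 - a) := by linarith
  have B0 : 0 < 1 - b := by linarith
  have hι : iotaA (cc a b) = (1 - a) * b * ((1 - b + 0 - b) * (a - (1 - b + 0))) /
      ((b + (1 - a)) * ((1 - b + 0) * (a * b - (a + b - 1) * (1 - b + 0)))) := by
    rw [add_zero, eq_div_iff (by positivity)]
    linear_combination (iota_spec hb hab ha hw hB hcrit).1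
  rw [hι]
  have hcont : ContinuousAt (fun ε : ℝ => (1 - a) * b * ((1 - b + ε - b) * (a - (1 - b + ε))) /
      ((b + (1 - a)) * ((1 - b + ε) * (a * b - (a + b - 1) * (1 - b + ε))))) 0 := by
    refine ContinuousAt.div (by fun_prop) (by fun_prop) ?_
    rw [add_zero]
    positivity
  refine Tendsto.congr' ?_ (hcont.tendsto.mono_left nhdsWithin_le_nhds)
  filter_upwards [hev] with ε hε
  exact (tunedEps_spec hb hab ha hw hB hcrit hε.1 hε.2).2.symm

/-- Makes the upper limit in `truthPay` a genuine limit, so that strict inequalities for t pass to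
small ε. -/
lemma exists_tendsto_symPay_tunedEps (hb : 0 < b) (hab : b < a) (ha : a < 1) (hB : b < 1 - b)
    (hw : 1 < a + b) :
    ∃ t, Tendsto (fun ε => symPay a b (tunedEps (cc a b) ε) honest) (𝓝[>] 0) (𝓝 t) := by
  have N0 := pos_scale hb (q := 1 - b) (by linarith) hab hB ha
  have B0 : 0 < 1 - b := by linarith
  have hζ : ContinuousAt (zetaEps (cc a b)) 0 := by
    have e : zetaEps (cc a b) = fun ε => (1 - a) * (1 - b) /
        (a * b - (a + b - 1) * (1 - b + ε)) := funext (zetaEps_cc a b)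
    rw [e]
    refine ContinuousAt.div (by fun_prop) (by fun_prop) ?_
    rw [add_zero]
    exact N0.ne'
  have hδ : ContinuousAt (deltaEps (cc a b)) 0 := by
    unfold deltaEps
    refine ContinuousAt.div (by fun_prop) (by fun_prop) ?_
    simp only [cc]
    have e : b * a * (1 - b + 0 - 1) - (1 - b) * (1 - a) * (1 - b + 0) =
        -(a * b - (a + b - 1) * (1 - b)) := by ring
    rw [e, add_zero]
    exact mul_ne_zero B0.ne' (neg_ne_zero.2 N0.ne')
  have hc : ContinuousAt (fun ε => symPay a b (tunedEps (cc a b) ε) honest) 0 := by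
    simp only [symPay_eq, payFor, tunedEps, mat]
    fun_prop
  exact ⟨_, hc.tendsto.mono_left nhdsWithin_le_nhds⟩

/-! ### The case distinction in the reduced model -/

lemma symOpt_eq {h : Bool → Bool → ℝ} {Δ : ℝ} (hh : Admissible a b h) (hΔ : symGap a b h = Δ)
    (hle : ∀ h, Admissible a b h → symGap a b h ≤ Δ) : symOpt a b = Δ :=
  IsGreatest.csSup_eq ⟨⟨h, hh, hΔ⟩, by rintro _ ⟨h, hh, rfl⟩; exact hle h hh⟩

/-- What has to be shown for the matrices `M` and `N ε` in terms of the reduced model. -/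
structure TunedSpec (a b : ℝ) (R₁₂ R₃ : Prop) (M : Bool → Bool → ℝ)
    (N : ℝ → Bool → Bool → ℝ) : Prop where
  attainable_iff : SymAttainable a b ↔ R₁₂
  not_attainable_iff : ¬ SymAttainable a b ↔ R₃
  opt_pos : 0 < symOpt a b
  tuned : SymAttainable a b → Admissible a b M ∧ symGap a b M = symOpt a b
  tunedEps : ¬ SymAttainable a b → (∀ᶠ ε in 𝓝[>] (0 : ℝ), Admissible a b (N ε)) ∧
    Tendsto (fun ε => symGap a b (N ε)) (𝓝[>] 0) (𝓝 (symOpt a b)) ∧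
    ∃ t, Tendsto (fun ε => symPay a b (N ε) honest) (𝓝[>] 0) (𝓝 t)

lemma TunedSpec.of_attained {M : Bool → Bool → ℝ} {N : ℝ → Bool → Bool → ℝ} {R₁₂ R₃ : Prop}
    {Δ : ℝ} (hΔ : 0 < Δ) (hM : Admissible a b M) (hgap : symGap a b M = Δ)
    (hle : ∀ h, Admissible a b h → symGap a b h ≤ Δ) (h12 : R₁₂) (h3 : ¬ R₃) :
    TunedSpec a b R₁₂ R₃ M N := by
  have ho := symOpt_eq hM hgap hle
  have hA : SymAttainable a b := ⟨M, hM, hgap.trans ho.symm⟩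
  exact ⟨iff_of_true hA h12, iff_of_false (not_not_intro hA) h3, by rw [ho]; exact hΔ,
    fun _ => ⟨hM, hgap.trans ho.symm⟩, fun h => absurd hA h⟩

lemma tunedSpec (hb : 0 < b) (hab : b < a) (ha : a < 1) (hw : 1 < a + b) :
    TunedSpec a b (InR1 (cc a b) ∨ InR2 (cc a b)) (InR3 (cc a b)) (tuned (cc a b))
      (tunedEps (cc a b)) := by
  have R1 : InR1 (cc a b) ↔ 1 - b ≤ b ∨
      (b < 1 - b ∧ 1 - b < qao (cc a b) ∧ deltaB (cc a b) ≤ deltaA (cc a b)) := Iff.rfl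
  have R2 : InR2 (cc a b) ↔
      (b < 1 - b ∧ 1 - b < qao (cc a b) ∧ deltaA (cc a b) < deltaB (cc a b)) ∨
      (b < 1 - b ∧ qao (cc a b) ≤ 1 - b ∧
        min (iotaA (cc a b)) (kappaA (cc a b)) ≤ deltaB (cc a b)) := Iff.rfl
  have R3 : InR3 (cc a b) ↔ b < 1 - b ∧ qao (cc a b) ≤ 1 - b ∧
      deltaB (cc a b) < min (iotaA (cc a b)) (kappaA (cc a b)) := Iff.rfl
  have hAle := fun h (hh : Admissible a b h) => symGap_le_deltaA hb hab ha hw hh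
  have hA0 := (deltaA_spec hb hab ha hw).1
  by_cases hcase : 1 - b < qao (cc a b)
  · have hin : InR1 (cc a b) := by
      rw [R1]
      rcases le_or_gt (1 - b) b with hB | hB
      · exact Or.inl hB
      · obtain ⟨-, h1, h2⟩ := lying_spec hb hab ha hw hB
        -- Δ_b is the gap of an admissible matrix, hence at most Δ_a: the first alternative of R₂
        -- never occurs.
        exact Or.inr ⟨hB, hcase, h2 ▸ hAle _ h1⟩
    have ht : tuned (cc a b) = mat (zeta (cc a b)) 0 0 1 := by rw [tuned, if_pos hin]
    obtain ⟨h1, h2⟩ := balanced_spec hb hab ha hw hcase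
    rw [ht]
    exact .of_attained hA0 h1 h2 hAle (Or.inl hin) fun h => (R3.1 h).2.1.not_gt hcase
  · rw [not_lt] at hcase
    have hB : b < 1 - b := (qao_spec hb hab ha hw).1.trans_le hcase
    obtain ⟨hι, hmin⟩ := iota_spec hb hab ha hw hB hcase
    obtain ⟨hB0, h1, h2⟩ := lying_spec hb hab ha hw hB
    have hle := fun h (hh : Admissible a b h) => symGap_le_deltaB hb hab ha hw hB hh hcase hι
    have hnot1 : ¬ InR1 (cc a b) := by
      rw [R1]
      rintro (h | ⟨-, h, -⟩)
      · exact hB.not_ge h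
      · exact hcase.not_gt h
    rw [hmin] at R2 R3
    rcases le_or_gt (iotaA (cc a b)) (deltaB (cc a b)) with hι' | hι'
    · have ht : tuned (cc a b) = mat 1 0 0 (eta (cc a b)) := by rw [tuned, if_neg hnot1]
      rw [ht]
      refine .of_attained hB0 h1 h2 (fun h hh => ?_) (Or.inr (R2.2 (Or.inr ⟨hB, hcase, hι'⟩)))
        fun h => (R3.1 h).2.2.not_ge hι'
      exact (hle h hh).elim id fun h => (h.trans_le hι').le
    · obtain ⟨hev, htend⟩ := tendsto_symGap_tunedEps hb hab ha hw hB hcase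
      have hlt : ∀ h, Admissible a b h → symGap a b h < iotaA (cc a b) := fun h hh =>
        (hle h hh).elim (fun h => h.trans_lt hι') id
      -- Every gap is strictly below ι, and the gaps of `tunedEps` tend to ι.
      have ho : symOpt a b = iotaA (cc a b) := by
        refine IsLUB.csSup_eq ⟨?_, fun u hu => ?_⟩ ⟨_, _, h1, rfl⟩
        · rintro _ ⟨h, hh, rfl⟩
          exact (hlt h hh).le
        · exact le_of_tendsto htend (hev.mono fun ε hε => hu ⟨_, hε, rfl⟩)
      have hna : ¬ SymAttainable a b := by
        rintro ⟨h, hh, e⟩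
        exact (hlt h hh).ne (e.trans ho)
      refine ⟨iff_of_false hna ?_, iff_of_true hna (R3.2 ⟨hB, hcase, hι'⟩), ?_,
        fun h => absurd h hna, fun _ => ⟨hev, by rw [ho]; exact htend,
          exists_tendsto_symPay_tunedEps hb hab ha hB hw⟩⟩
      · rintro (h | h)
        · exact hnot1 h
        · rcases R2.1 h with ⟨-, h, -⟩ | ⟨-, -, h⟩
          · exact hcase.not_gt h
          · exact hι'.not_ge h
      · rw [ho]; exact hB0.trans hι'

lemma TunedSpec.flip {M : Bool → Bool → ℝ} {N : ℝ → Bool → Bool → ℝ} {R₁₂ R₃ : Prop}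
    (H : TunedSpec (1 - b) (1 - a) R₁₂ R₃ M N) :
    TunedSpec a b R₁₂ R₃ (flipMat M) (fun ε => flipMat (N ε)) := by
  have hg : ∀ h, symGap a b (flipMat h) = symGap (1 - b) (1 - a) h := fun h => by
    rw [← symGap_flip, flipMat_flipMat]
  have had : ∀ h, Admissible a b (flipMat h) ↔ Admissible (1 - b) (1 - a) h := fun h => by
    rw [← admissible_flip_iff, flipMat_flipMat]
  have hp : ∀ h, symPay a b (flipMat h) honest = symPay (1 - b) (1 - a) h honest := fun h => by
    rw [← symPay_flip, flipMat_flipMat, flipStrategy_honest]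
  have hA := symAttainable_flip_iff (a := a) (b := b)
  have ho := symOpt_flip (a := a) (b := b)
  obtain ⟨h1, h2, h3, h4, h5⟩ := H
  rw [hA] at h1 h2 h4 h5
  rw [ho] at h3 h4 h5
  refine ⟨h1, h2, h3, ?_, ?_⟩
  · simpa only [hg, had] using h4
  · simpa only [hg, had, hp] using h5

end

noncomputable section

/-! ### The theorem -/

variable {n : ℕ} {Q : (Fin n → Bool) → ℝ} {a b : ℝ}

/-- The mechanisms of the original orientation satisfy the specification. -/
lemma PairLaw.tunedSpec (H : PairLaw Q a b) (hc : qc Q = cc a b) (hne : a + b ≠ 1) :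
    TunedSpec a b (InR1 (oriented Q) ∨ InR2 (oriented Q)) (InR3 (oriented Q)) (PPM Q)
      (PPMEps Q) := by
  have hb := H.b_pos
  have hab := H.b_lt
  have ha := H.a_lt
  rcases lt_or_gt_of_ne hne with hw | hw
  · have hlt : ¬ qc Q false false < qc Q true true := by
      rw [hc]; simp only [cc]; linarith
    have ho : oriented Q = cc (1 - b) (1 - a) := by
      rw [oriented, if_neg hlt, hc, cc_flip]
    have hu : ∀ h, unorient Q h = flipMat h := fun h => by rw [unorient, if_neg hlt]; rfl
    have hM : PPM Q = flipMat (tuned (cc (1 - b) (1 - a))) := by rw [PPM, hu, ho]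
    have hN : PPMEps Q = fun ε => flipMat (tunedEps (cc (1 - b) (1 - a)) ε) := by
      funext ε; rw [PPMEps, hu, ho]
    rw [ho, hM, hN]
    exact (PeerPrediction.tunedSpec (by linarith) (by linarith) (by linarith) (by linarith)).flip
  · have hlt : qc Q false false < qc Q true true := by
      rw [hc]; simp only [cc]; linarith
    have ho : oriented Q = cc a b := by rw [oriented, if_pos hlt, hc]
    have hu : ∀ h, unorient Q h = h := fun h => by rw [unorient, if_pos hlt]
    have hM : PPM Q = tuned (cc a b) := by rw [PPM, hu, ho]
    have hN : PPMEps Q = tunedEps (cc a b) := by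
      funext ε; rw [PPMEps, hu, ho]
    rw [ho, hM, hN]
    exact PeerPrediction.tunedSpec hb hab ha hw

/-- Truth-telling pays at most `1`, also in the limit. -/
lemma PairLaw.truthPay_mem (H : PairLaw Q a b) (hc : qc Q = cc a b) {R₁₂ R₃ : Prop}
    (S : TunedSpec a b R₁₂ R₃ (PPM Q) (PPMEps Q)) :
    truthPay Q ≤ 1 ∧ (SymAttainable a b → truthPay Q = symPay a b (PPM Q) honest) ∧
      (¬ SymAttainable a b →
        Tendsto (fun ε => symPay a b (PPMEps Q ε) honest) (𝓝[>] 0) (𝓝 (truthPay Q))) := by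
  have hle : ∀ h, Admissible a b h → symPay a b h honest ≤ 1 := fun h hh =>
    (symPay_mem H.b_pos H.b_lt.le H.a_lt.le hh.1 _).2
  have hiff := H.isAttainable_iff hc
  by_cases hA : SymAttainable a b
  · have ht : truthPay Q = symPay a b (PPM Q) honest := by
      rw [truthPay, if_pos (hiff.2 hA), truth_eq, H.value_const]
    refine ⟨?_, fun _ => ht, fun h => absurd hA h⟩
    rw [ht]
    exact hle _ (S.tuned hA).1
  · obtain ⟨h1, -, t, h2⟩ := S.tunedEps hA
    have ht : truthPay Q = t := by
      rw [truthPay, if_neg (fun h => hA (hiff.1 h))]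
      simp only [truth_eq, H.value_const]
      exact h2.limsup_eq
    rw [ht]
    exact ⟨le_of_tendsto h2 (h1.mono fun ε hε => hle _ hε), fun h => absurd h hA, fun _ => h2⟩

/-- The threshold, expressed by `a = q(1|1)` and `b = q(1|0)`. -/
lemma PairLaw.threshold_congr (H : PairLaw Q a b) (hc : qc Q = cc a b) {m : ℕ}
    {Q' : (Fin m → Bool) → ℝ} (H' : PairLaw Q' a b) (hc' : qc Q' = cc a b) :
    threshold Q = threshold Q' := by
  have ho : oriented Q = oriented Q' := by simp only [oriented, hc, hc']
  have hu : ∀ h, unorient Q h = unorient Q' h := fun h => by simp only [unorient, hc, hc']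
  have ht : truthPay Q = truthPay Q' := by
    have hiff : IsAttainable Q ↔ IsAttainable Q' :=
      (H.isAttainable_iff hc).trans (H'.isAttainable_iff hc').symm
    simp only [truthPay, truth_eq, H.value_const, H'.value_const, PPM, PPMEps, ho, hu]
    by_cases hA : IsAttainable Q
    · rw [if_pos hA, if_pos (hiff.1 hA)]
    · rw [if_neg hA, if_neg fun h => hA (hiff.2 h)]
  rw [threshold, threshold, ht, H.optGap_eq hc, H'.optGap_eq hc']

/-- ξ(a, b) is read off from an arbitrarily chosen prior with these parameters; by `threshold_congr`
the choice is immaterial. The value 0 is given where no such prior exists. -/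
lemma exists_threshold : ∃ ξ : ℝ → ℝ → ℝ, ∀ (n : ℕ) (Q : (Fin n → Bool) → ℝ) (a b : ℝ),
    PairLaw Q a b → qc Q = cc a b → threshold Q = ξ a b := by
  classical
  refine ⟨fun u v => if h : ∃ (m : ℕ) (Q' : (Fin m → Bool) → ℝ),
    PairLaw Q' u v ∧ qc Q' = cc u v then threshold h.choose_spec.choose else 0, ?_⟩
  intro n Q a b H hc
  have hex : ∃ (m : ℕ) (Q' : (Fin m → Bool) → ℝ), PairLaw Q' a b ∧ qc Q' = cc a b :=
    ⟨n, Q, H, hc⟩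
  beta_reduce
  rw [dif_pos hex]
  exact H.threshold_congr hc hex.choose_spec.choose_spec.1 hex.choose_spec.choose_spec.2

end

end PeerPrediction

open PeerPrediction in
theorem mainTheorem1 :
    ∃ ξ : ℝ → ℝ → ℝ, ∀ (n : ℕ) (Q : (Fin n → Bool) → ℝ), 2 ≤ n →
      Q ∈ stdSimplex ℝ (Fin n → Bool) → IsSymmetric Q → IsPositivelyCorrelated Q →
      IsSignalAsymmetric Q → 0 < qc Q true false →
      -- attainability is decided by the regions
      ((IsAttainable Q ↔ InR1 (oriented Q) ∨ InR2 (oriented Q)) ∧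
        (¬ IsAttainable Q ↔ InR3 (oriented Q))) ∧
      -- part (1)
      (IsAttainable Q →
        PPM Q ∈ unitMechanisms Q ∧ gap Q (PPM Q) = optGap Q ∧
          IsTruthBestInformative Q (ppPayment (PPM Q))) ∧
      (¬ IsAttainable Q →
        (∀ᶠ ε in 𝓝[>] (0 : ℝ), PPMEps Q ε ∈ unitMechanisms Q ∧
          IsTruthBestInformative Q (ppPayment (PPMEps Q ε))) ∧
        Tendsto (fun ε : ℝ => gap Q (PPMEps Q ε)) (𝓝[>] 0) (𝓝 (optGap Q))) ∧
      -- part (2)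
      threshold Q = ξ (qc Q true true) (qc Q true false) ∧ 0 < threshold Q ∧
      (0 < epsQ Q → epsQ Q < threshold Q →
        (IsAttainable Q → IsFocal Q (MPPM Q) (truth n)) ∧
        (¬ IsAttainable Q → ∀ᶠ ε in 𝓝[>] (0 : ℝ), IsFocal Q (MPPMEps Q ε) (truth n))) := by
  obtain ⟨ξ, hξ⟩ := exists_threshold
  refine ⟨ξ, ?_⟩
  intro n Q hn hQ hs hp has hb0
  obtain ⟨a, b, H, hc, hne⟩ := exists_pairLaw hn hQ hs hp has hb0
  have S := H.tunedSpec hc hne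
  have hiff := H.isAttainable_iff hc
  have hmem := fun h => mem_unitMechanisms_iff H.b_pos H.b_lt H.a_lt hc h
  have hopt := H.optGap_eq hc
  have hpos := S.opt_pos
  obtain ⟨ht1, htA, htN⟩ := H.truthPay_mem hc S
  have hden : 0 < 1 - truthPay Q + optGap Q := by rw [hopt]; linarith
  refine ⟨⟨hiff.trans S.attainable_iff, (not_congr hiff).trans S.not_attainable_iff⟩, ?_, ?_, ?_,
    ?_, ?_⟩
  · intro hA
    obtain ⟨h1, h2⟩ := S.tuned (hiff.1 hA)
    exact ⟨(hmem _).2 h1, by rw [H.gap_eq h1, h2, hopt],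
      H.isTruthBestInformative h1 (by rw [h2]; exact hpos)⟩
  · intro hA
    obtain ⟨h1, h2, -⟩ := S.tunedEps (fun h => hA (hiff.2 h))
    refine ⟨?_, ?_⟩
    · filter_upwards [h1, h2.eventually (lt_mem_nhds hpos)] with ε e1 e2
      exact ⟨(hmem _).2 e1, H.isTruthBestInformative e1 e2⟩
    · rw [hopt]
      exact h2.congr' (h1.mono fun ε e1 => (H.gap_eq e1).symm)
  · have e1 : qc Q true true = a := by rw [hc]; rfl
    have e2 : qc Q true false = b := by rw [hc]; rfl
    rw [e1, e2]
    exact hξ n Q a b H hc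
  · rw [threshold]
    exact div_pos (by rw [hopt]; exact hpos) hden
  · intro h0 hlt
    rw [threshold, lt_div_iff₀ hden] at hlt
    have hε1 : epsQ Q < 1 := by
      by_contra hge
      have h1 := mul_le_mul_of_nonneg_right (not_lt.1 hge) hden.le
      linarith
    have hε : 0 < 1 - epsQ Q := by linarith
    have hG : 0 < optGap Q := by rw [hopt]; exact hpos
    -- p is the midpoint of the interval from (1 - t)/(1 - ε_Q) to Δ*/ε_Q. The inequality `k`, a
    -- rearrangement of ε_Q < ξ, says that the interval is nonempty; `hpay` and `hgap` say that p
    -- exceeds its lower end and is below its upper end.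
    set p := punishment Q with hpdef
    have hp : p = (1 - truthPay Q) / (2 * (1 - epsQ Q)) + optGap Q / (2 * epsQ Q) := rfl
    have hp0 : 0 ≤ p := by
      rw [hp]
      exact add_nonneg (div_nonneg (by linarith) (by linarith)) (div_nonneg hG.le (by linarith))
    have k : (1 - truthPay Q) * epsQ Q < optGap Q * (1 - epsQ Q) := by linarith
    have hgap : p * epsQ Q < symOpt a b := by
      rw [← hopt]
      have e : optGap Q - p * epsQ Q = (optGap Q * (1 - epsQ Q) - (1 - truthPay Q) * epsQ Q) /
          (2 * (1 - epsQ Q)) := by rw [hp]; field_simp; ring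
      have : 0 < optGap Q - p * epsQ Q := by rw [e]; exact div_pos (by linarith) (by linarith)
      linarith
    have hpay : 1 - p < truthPay Q - p * epsQ Q := by
      have e : p * (1 - epsQ Q) - (1 - truthPay Q) =
          (optGap Q * (1 - epsQ Q) - (1 - truthPay Q) * epsQ Q) / (2 * epsQ Q) := by
        rw [hp]; field_simp; ring
      have : 0 < p * (1 - epsQ Q) - (1 - truthPay Q) := by
        rw [e]; exact div_pos (by linarith) (by linarith)
      linarith
    refine ⟨fun hA => ?_, fun hA => ?_⟩
    · have hA' := hiff.1 hA
      obtain ⟨h1, h2⟩ := S.tuned hA'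
      rw [htA hA'] at hpay
      exact H.isFocal_punished h1 hp0 (by rw [h2]; exact hgap) hpay
    · have hA' : ¬ SymAttainable a b := fun h => hA (hiff.2 h)
      obtain ⟨h1, h2, -⟩ := S.tunedEps hA'
      have hpay' : 1 - p + p * epsQ Q < truthPay Q := by linarith
      -- Both conditions on p are strict in the limit, so they hold for all small ε.
      filter_upwards [h1, h2.eventually (lt_mem_nhds hgap),
        (htN hA').eventually (lt_mem_nhds hpay')] with ε e1 e2 e3
      exact H.isFocal_punished e1 hp0 e2 (by linarith)
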